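/- A compact quantum group $G=(Q,\Delta)$ is a nonzero unital $C^*$-algebra $Q$ with a coassociative unital $*$-homomorphism $\Delta:Q\to Q\otimes Q$ (minimal tensor product) such that $(1\otimes Q)\Delta(Q)$ and $(Q\otimes 1)\Delta(Q)$ span dense subspaces of $Q\otimes Q$. A finite-dimensional representation of $G$ is a unitary matrix $u=(u_{ij})$ over $Q$ with $\Delta(u_{ij})=\sum_k u_{ik}\otimes u_{kj}$. Let $\mathcal Q_G\subseteq Q$ be the canonical Hopf $*$-algebra of $G$, i.e. the $*$-subalgebra generated (equivalently, linearly spanned) by the matrix coefficients of the finite-dimensional representations of $G$, and let $\operatorname{Rep}G$ be the Grothendieck ring of finite-dimensional representations of $G$ under direct sum and tensor product. One says that $G$ is - *connected* if the trivial representation is its only torsion irreducible representation, where an irreducible representation $u$ is *torsion* if, up to isomorphism, only finitely many irreducible representations occur in the tensor powers of $u\oplus u^*$ ($u^*$ being the conjugate of $u$); - *irreducible* if $\mathcal Q_G$ is a (possibly noncommutative) domain; - *weakly irreducible* if $\operatorname{Rep}G$ is a (possibly noncommutative) domain. Let $(G_i)_{i\in I}$ be an inverse system of compact quantum groups over a nonempty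 directed set $I$; that is, the $\mathcal Q_{G_i}$ form a direct system of Hopf $*$-algebras. Let the compact quantum group $G$ be its inverse limit, which means that $\mathcal Q_G$ is the direct limit of the Hopf $*$-algebras $\mathcal Q_{G_i}$. Then: 1. if every $G_i$ is connected, then $G$ is connected; 2. if every $G_i$ is irreducible, then $G$ is irreducible; 3. if every $G_i$ is weakly irreducible, then $G$ is weakly irreducible. -/

import Mathlib

open scoped TensorProduct

noncomputable section

/-- The Hilbert space tensor product `H ⊗ K`: the completion of the algebraic tensor product for
the inner product `⟪ξ ⊗ η, ξ' ⊗ η'⟫ = ⟪ξ, ξ'⟫ ⟪η, η'⟫`. -/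
def HilbertTensor (H K : Type*) [NormedAddCommGroup H] [InnerProductSpace ℂ H]
    [NormedAddCommGroup K] [InnerProductSpace ℂ K] : Type _ :=
  UniformSpace.Completion (H ⊗[ℂ] K)

namespace HilbertTensor

variable {H K : Type*} [NormedAddCommGroup H] [InnerProductSpace ℂ H]
    [NormedAddCommGroup K] [InnerProductSpace ℂ K]

instance : NormedAddCommGroup (HilbertTensor H K) :=
  inferInstanceAs (NormedAddCommGroup (UniformSpace.Completion (H ⊗[ℂ] K)))

instance : InnerProductSpace ℂ (HilbertTensor H K) :=
  inferInstanceAs (InnerProductSpace ℂ (UniformSpace.Completion (H ⊗[ℂ] K)))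

instance : CompleteSpace (HilbertTensor H K) :=
  inferInstanceAs (CompleteSpace (UniformSpace.Completion (H ⊗[ℂ] K)))

variable (H K) in
/-- The inclusion of the algebraic tensor product. -/
def incl : H ⊗[ℂ] K →ₗᵢ[ℂ] HilbertTensor H K :=
  UniformSpace.Completion.toComplₗᵢ (𝕜 := ℂ) (E := H ⊗[ℂ] K)

/-- The elementary tensor `ξ ⊗ η`. -/
def tmul (ξ : H) (η : K) : HilbertTensor H K := incl H K (ξ ⊗ₜ[ℂ] η)

theorem denseRange_incl : DenseRange (incl H K) :=
  UniformSpace.Completion.denseRange_coe (α := H ⊗[ℂ] K)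

theorem ext_tmul {S T : HilbertTensor H K →L[ℂ] HilbertTensor H K}
    (h : ∀ ξ η, S (tmul ξ η) = T (tmul ξ η)) : S = T := by
  ext x
  refine denseRange_incl.induction_on (p := fun x => S x = T x) x
    (isClosed_eq S.continuous T.continuous) fun x => ?_
  induction x with
  | zero => simp
  | tmul ξ η => exact h ξ η
  | add x y hx hy => simp only [map_add, hx, hy]

theorem inner_tmul_tmul (ξ ξ' : H) (η η' : K) :
    inner ℂ (tmul ξ η) (tmul ξ' η') = inner ℂ ξ ξ' * inner ℂ η η' := by
  simp [tmul]

/-- The bounded operator `S ⊗ T` on `H ⊗ K`. -/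
def map (S : H →L[ℂ] H) (T : K →L[ℂ] K) : HilbertTensor H K →L[ℂ] HilbertTensor H K :=
  (TensorProduct.mapL S T).completion

@[simp] theorem map_tmul (S : H →L[ℂ] H) (T : K →L[ℂ] K) (ξ : H) (η : K) :
    map S T (tmul ξ η) = tmul (S ξ) (T η) := by
  exact ContinuousLinearMap.completion_apply_coe (TensorProduct.mapL S T) (ξ ⊗ₜ[ℂ] η)

theorem tmul_add (ξ : H) (η η' : K) : tmul ξ (η + η') = tmul ξ η + tmul ξ η' := by
  simp [tmul, TensorProduct.tmul_add]
theorem add_tmul (ξ ξ' : H) (η : K) : tmul (ξ + ξ') η = tmul ξ η + tmul ξ' η := by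
  simp [tmul, TensorProduct.add_tmul]
theorem tmul_smul (c : ℂ) (ξ : H) (η : K) : tmul ξ (c • η) = c • tmul ξ η := by
  simp [tmul, TensorProduct.tmul_smul]
theorem smul_tmul (c : ℂ) (ξ : H) (η : K) : tmul (c • ξ) η = c • tmul ξ η := by
  simp [tmul, ← TensorProduct.smul_tmul']

theorem ext_inner {x y : HilbertTensor H K}
    (h : ∀ ξ η, inner ℂ (tmul ξ η) x = inner ℂ (tmul ξ η) y) : x = y := by
  apply ext_inner_left ℂ
  intro z
  refine denseRange_incl.induction_on (p := fun z => inner ℂ z x = inner ℂ z y) z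
    (isClosed_eq (by fun_prop) (by fun_prop)) fun z => ?_
  induction z with
  | zero => simp
  | tmul ξ η => exact h ξ η
  | add x y hx hy => simp only [map_add, inner_add_left, hx, hy]

theorem star_map [CompleteSpace H] [CompleteSpace K] (S : H →L[ℂ] H) (T : K →L[ℂ] K) :
    star (map S T) = map (star S) (star T) := by
  refine ext_tmul fun ξ η => ext_inner fun ξ' η' => ?_
  rw [ContinuousLinearMap.star_eq_adjoint, ContinuousLinearMap.adjoint_inner_right]
  simp [inner_tmul_tmul, ContinuousLinearMap.star_eq_adjoint,
    ContinuousLinearMap.adjoint_inner_right]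

end HilbertTensor

section Spatial
variable {A B : Type*} {H K : Type*} [Ring A] [StarRing A] [Algebra ℂ A] [StarModule ℂ A]
  [Ring B] [StarRing B] [Algebra ℂ B] [StarModule ℂ B]
  [NormedAddCommGroup H] [InnerProductSpace ℂ H] [CompleteSpace H]
  [NormedAddCommGroup K] [InnerProductSpace ℂ K] [CompleteSpace K]

/-- The tensor product representation `a ⊗ b ↦ π(a) ⊗ ρ(b)`. -/
def tensorRep (π : A →⋆ₐ[ℂ] (H →L[ℂ] H)) (ρ : B →⋆ₐ[ℂ] (K →L[ℂ] K)) :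
    A ⊗[ℂ] B →⋆ₐ[ℂ] (HilbertTensor H K →L[ℂ] HilbertTensor H K) :=
  let l : A ⊗[ℂ] B →ₐ[ℂ] (HilbertTensor H K →L[ℂ] HilbertTensor H K) :=
    Algebra.TensorProduct.algHomOfLinearMapTensorProduct
      (TensorProduct.lift (LinearMap.mk₂ ℂ (fun a b => HilbertTensor.map (π a) (ρ b))
        (fun _ _ _ => HilbertTensor.ext_tmul fun _ _ => by simp [HilbertTensor.add_tmul])
        (fun _ _ _ => HilbertTensor.ext_tmul fun _ _ => by simp [HilbertTensor.smul_tmul])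
        (fun _ _ _ => HilbertTensor.ext_tmul fun _ _ => by simp [HilbertTensor.tmul_add])
        (fun _ _ _ => HilbertTensor.ext_tmul fun _ _ => by simp [HilbertTensor.tmul_smul])))
      (fun _ _ _ _ => HilbertTensor.ext_tmul fun _ _ => by simp)
      (HilbertTensor.ext_tmul fun _ _ => by simp)
  { l with
    map_star' := fun x => by
      change l (star x) = star (l x)
      induction x with
      | zero => rw [star_zero, map_zero, star_zero]
      | tmul a b =>
        change HilbertTensor.map (π (star a)) (ρ (star b)) = star (HilbertTensor.map (π a) (ρ b))
        rw [HilbertTensor.star_map, map_star, map_star]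
      | add x y hx hy => rw [star_add, map_add, map_add, star_add, hx, hy] }

@[simp] theorem tensorRep_tmul (π : A →⋆ₐ[ℂ] (H →L[ℂ] H)) (ρ : B →⋆ₐ[ℂ] (K →L[ℂ] K))
    (a : A) (b : B) : tensorRep π ρ (a ⊗ₜ b) = HilbertTensor.map (π a) (ρ b) := rfl

theorem tensorRep_injective {π : A →⋆ₐ[ℂ] (H →L[ℂ] H)} {ρ : B →⋆ₐ[ℂ] (K →L[ℂ] K)}
    (hπ : Function.Injective π) (hρ : Function.Injective ρ) :
    Function.Injective (tensorRep π ρ) := by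
  rw [injective_iff_map_eq_zero]
  intro t ht
  classical
  let b := Module.Basis.ofVectorSpace ℂ B
  obtain ⟨c, rfl⟩ := (TensorProduct.equivFinsuppOfBasisRight (M := A) b).symm.surjective t
  rw [TensorProduct.equivFinsuppOfBasisRight_symm_apply] at ht
  have key : ∀ ξ ξ' : H, ∀ i, inner ℂ ξ (π (c i) ξ') = 0 := by
    intro ξ ξ'
    have h0 : ρ (c.sum fun i a => (inner ℂ ξ (π a ξ') : ℂ) • b i) = 0 := by
      ext η
      apply ext_inner_left ℂ
      intro η'
      have := congrArg (fun T => inner ℂ (HilbertTensor.tmul ξ η') (T (HilbertTensor.tmul ξ' η))) ht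
      simpa [Finsupp.sum, HilbertTensor.inner_tmul_tmul, sum_apply, inner_sum,
        inner_smul_right] using this
    have h1 := (injective_iff_map_eq_zero ρ).1 hρ _ h0
    have h2 := (linearIndependent_iff'.1 b.linearIndependent) c.support
      (fun i => (inner ℂ ξ (π (c i) ξ') : ℂ)) h1
    intro i
    by_cases hi : i ∈ c.support
    · exact h2 i hi
    · simp [Finsupp.notMem_support_iff.1 hi]
  have hc : c = 0 := by
    ext i
    apply hπ
    ext ξ'
    apply ext_inner_left ℂ
    intro ξ
    simpa using key ξ ξ' i
  simp [hc]

/-- The minimal (spatial) tensor product `A ⊗ B`, formed with the help of representations `π` of `A`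
and `ρ` of `B` on Hilbert spaces: the norm closure of the linear span of the `π(a) ⊗ ρ(b)` in the
bounded operators on `H ⊗ K`. For faithful representations of C⋆-algebras it does not depend on
the choice of `π` and `ρ`. -/
def minTensor (π : A →⋆ₐ[ℂ] (H →L[ℂ] H)) (ρ : B →⋆ₐ[ℂ] (K →L[ℂ] K)) :
    StarSubalgebra ℂ (HilbertTensor H K →L[ℂ] HilbertTensor H K) :=
  (tensorRep π ρ).range.topologicalClosure

/-- The canonical map from the algebraic to the minimal tensor product. -/
def toMinTensor (π : A →⋆ₐ[ℂ] (H →L[ℂ] H)) (ρ : B →⋆ₐ[ℂ] (K →L[ℂ] K)) :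
    A ⊗[ℂ] B →⋆ₐ[ℂ] minTensor π ρ :=
  (tensorRep π ρ).codRestrict _ fun x => StarSubalgebra.le_topologicalClosure _
      (AlgHom.mem_range _ |>.2 ⟨x, rfl⟩)

end Spatial

open HilbertTensor in
/-- Coassociativity `(Δ ⊗ id) Δ = (id ⊗ Δ) Δ` of a unital ⋆-homomorphism `Δ : A → A ⊗ A`.
`L` is `Δ ⊗ id : A ⊗ A → (A ⊗ A) ⊗ A` and `R` is `id ⊗ Δ : A ⊗ A → A ⊗ (A ⊗ A)`: these are the
unique ⋆-homomorphisms with the given values on elementary tensors. The last clause says that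
`L (Δ a)` and `R (Δ a)` agree under the canonical identification `(H ⊗ H) ⊗ H ≃ H ⊗ (H ⊗ H)`; it is
expressed by matrix elements with respect to elementary tensors, which span a dense subspace. -/
def IsCoassociative {A H : Type*} [Ring A] [StarRing A] [Algebra ℂ A] [StarModule ℂ A]
    [NormedAddCommGroup H] [InnerProductSpace ℂ H] [CompleteSpace H]
    (π : A →⋆ₐ[ℂ] (H →L[ℂ] H)) (Δ : A →⋆ₐ[ℂ] minTensor π π) : Prop :=
  ∃ (L : minTensor π π →⋆ₐ[ℂ] minTensor (minTensor π π).subtype π)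
    (R : minTensor π π →⋆ₐ[ℂ] minTensor π (minTensor π π).subtype),
    (∀ a b, L (toMinTensor π π (a ⊗ₜ b)) = toMinTensor (minTensor π π).subtype π (Δ a ⊗ₜ b)) ∧
    (∀ a b, R (toMinTensor π π (a ⊗ₜ b)) = toMinTensor π (minTensor π π).subtype (a ⊗ₜ Δ b)) ∧
    ∀ (a : A) (ξ η ζ ξ' η' ζ' : H),
      inner ℂ (tmul (tmul ξ η) ζ) ((L (Δ a)).1 (tmul (tmul ξ' η') ζ')) =
        inner ℂ (tmul ξ (tmul η ζ)) ((R (Δ a)).1 (tmul ξ' (tmul η' ζ')))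

universe u

/-- A compact quantum group `G = (Q, Δ)`: a (nonzero) unital C⋆-algebra `Q` with a coassociative unital
⋆-homomorphism `Δ : Q → Q ⊗ Q` into the minimal tensor product such that the linear spans of
`(1 ⊗ Q) Δ(Q)` and `(Q ⊗ 1) Δ(Q)` are dense in `Q ⊗ Q`. The Hilbert space `space` with the faithful
representation `rep` of `Q` serves to form the minimal tensor products; such a representation
always exists, and the tensor products do not depend on it. -/
structure CompactQuantumGroup where
  /-- The C⋆-algebra `Q`. -/
  alg : Type u
  [cstarAlgebra : CStarAlgebra alg]
  [nontrivial : Nontrivial alg]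
  /-- The Hilbert space on which `Q` is represented. -/
  space : Type u
  [normedAddCommGroup : NormedAddCommGroup space]
  [innerProductSpace : InnerProductSpace ℂ space]
  [completeSpace : CompleteSpace space]
  /-- A faithful representation of `Q`. -/
  rep : alg →⋆ₐ[ℂ] (space →L[ℂ] space)
  rep_injective : Function.Injective rep
  /-- The coproduct `Δ`. -/
  comul : alg →⋆ₐ[ℂ] minTensor rep rep
  coassoc : IsCoassociative rep comul
  dense_left : Dense (Submodule.span ℂ
    {x | ∃ a b, x = toMinTensor rep rep (1 ⊗ₜ b) * comul a} : Set (minTensor rep rep))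
  dense_right : Dense (Submodule.span ℂ
    {x | ∃ a b, x = toMinTensor rep rep (b ⊗ₜ 1) * comul a} : Set (minTensor rep rep))

namespace CompactQuantumGroup

attribute [instance] cstarAlgebra nontrivial normedAddCommGroup innerProductSpace completeSpace

/-- The inclusion of the algebraic into the minimal tensor product of `Q` with itself. -/
abbrev algTensor (G : CompactQuantumGroup.{u}) :
    G.alg ⊗[ℂ] G.alg →⋆ₐ[ℂ] minTensor G.rep G.rep :=
  toMinTensor G.rep G.rep

/-- A finite-dimensional unitary representation of `G` on the Hilbert space `ℂ^ι`: a unitary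
`u ∈ M_ι(Q)` with `Δ(u_ij) = ∑ k, u_ik ⊗ u_kj`. -/
structure FinDimRep (G : CompactQuantumGroup.{u}) where
  /-- The index set of an orthonormal basis of the representation space. -/
  ι : Type
  [fintype : Fintype ι]
  [decidableEq : DecidableEq ι]
  /-- The matrix of coefficients. -/
  mat : Matrix ι ι G.alg
  mem_unitary : mat ∈ unitary (Matrix ι ι G.alg)
  comul_mat : ∀ i j, G.comul (mat i j) = ∑ k, G.algTensor (mat i k ⊗ₜ mat k j)

namespace FinDimRep

attribute [instance] fintype decidableEq

variable {G : CompactQuantumGroup.{u}}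

variable (G) in
/-- A complex matrix, seen as a matrix over `Q`. -/
def scalar {m n : Type} (T : Matrix m n ℂ) : Matrix m n G.alg := T.map (algebraMap ℂ G.alg)

theorem scalar_mul {l m n : Type} [Fintype m] (S : Matrix l m ℂ) (T : Matrix m n ℂ) :
    scalar G (S * T) = scalar G S * scalar G T := by
  simp only [scalar, Matrix.map_mul]

@[simp] theorem scalar_one {n : Type} [DecidableEq n] :
    scalar G (1 : Matrix n n ℂ) = 1 := by
  simp [scalar]

/-- `T` is an intertwiner from `u` to `v`. -/
def Intertwines (u v : FinDimRep G) (T : Matrix v.ι u.ι ℂ) : Prop :=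
  scalar G T * u.mat = v.mat * scalar G T

/-- Isomorphism of representations: there is an invertible intertwiner. -/
def Equivalent (u v : FinDimRep G) : Prop :=
  ∃ (T : Matrix v.ι u.ι ℂ) (S : Matrix u.ι v.ι ℂ), Intertwines u v T ∧ S * T = 1 ∧ T * S = 1

theorem Equivalent.refl (u : FinDimRep G) : Equivalent u u :=
  ⟨1, 1, by simp [Intertwines], by simp, by simp⟩

theorem Equivalent.symm {u v : FinDimRep G} (h : Equivalent u v) : Equivalent v u := by
  obtain ⟨T, S, hT, h1, h2⟩ := h
  refine ⟨S, T, ?_, h2, h1⟩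
  have h1' : scalar G S * scalar G T = 1 := by rw [← scalar_mul, h1, scalar_one]
  have h2' : scalar G T * scalar G S = 1 := by rw [← scalar_mul, h2, scalar_one]
  calc scalar G S * v.mat = scalar G S * (v.mat * scalar G T) * scalar G S := by
        rw [Matrix.mul_assoc, Matrix.mul_assoc, h2', Matrix.mul_one]
    _ = u.mat * scalar G S := by
        rw [← hT, ← Matrix.mul_assoc, h1', Matrix.one_mul]

theorem Equivalent.trans {u v w : FinDimRep G} (h : Equivalent u v) (h' : Equivalent v w) :
    Equivalent u w := by
  obtain ⟨T, S, hT, h1, h2⟩ := h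
  obtain ⟨T', S', hT', h1', h2'⟩ := h'
  refine ⟨T' * T, S * S', ?_, ?_, ?_⟩
  · unfold Intertwines at *
    rw [scalar_mul, Matrix.mul_assoc, hT, ← Matrix.mul_assoc, hT', Matrix.mul_assoc]
  · rw [Matrix.mul_assoc, ← Matrix.mul_assoc S', h1', Matrix.one_mul, h1]
  · rw [Matrix.mul_assoc, ← Matrix.mul_assoc T, h2, Matrix.one_mul, h2']

theorem equivalent_of_equiv {u v : FinDimRep G} (e : u.ι ≃ v.ι)
    (h : ∀ i j, u.mat i j = v.mat (e i) (e j)) : Equivalent u v := by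
  refine ⟨Matrix.of fun i j => if i = e j then 1 else 0,
    Matrix.of fun i j => if e i = j then 1 else 0, ?_, ?_, ?_⟩
  · ext i j
    obtain ⟨i, rfl⟩ := e.surjective i
    simp [scalar, Matrix.mul_apply, apply_ite (algebraMap ℂ G.alg), h]
  · ext i j
    simp [Matrix.mul_apply, Matrix.one_apply]
  · ext i j
    obtain ⟨i, rfl⟩ := e.surjective i
    obtain ⟨j, rfl⟩ := e.surjective j
    simp [Matrix.mul_apply, Matrix.one_apply, eq_comm]

/-- The trivial representation, on `ℂ`. -/
def trivial (G : CompactQuantumGroup.{u}) : FinDimRep G where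
  ι := Unit
  mat := 1
  mem_unitary := one_mem _
  comul_mat i j := by
    simp [← Algebra.TensorProduct.one_def]

/-- The representation on the zero space. -/
def zero (G : CompactQuantumGroup.{u}) : FinDimRep G where
  ι := Empty
  mat := 1
  mem_unitary := one_mem _
  comul_mat i := i.elim

/-- The direct sum of two representations. -/
def directSum (u v : FinDimRep G) : FinDimRep G where
  ι := u.ι ⊕ v.ι
  mat := Matrix.fromBlocks u.mat 0 0 v.mat
  mem_unitary := by
    have hu := Unitary.mem_iff.1 u.mem_unitary
    have hv := Unitary.mem_iff.1 v.mem_unitary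
    simp only [Matrix.star_eq_conjTranspose] at hu hv
    rw [Unitary.mem_iff, Matrix.star_eq_conjTranspose, Matrix.fromBlocks_conjTranspose,
      Matrix.fromBlocks_multiply, Matrix.fromBlocks_multiply]
    simp [hu, hv]
  comul_mat := by
    rintro (i | i) (j | j) <;> simp [u.comul_mat, v.comul_mat]

open scoped Kronecker in
/-- The tensor product of two representations, with coefficients `u_ij v_kl`. -/
def tensor (u v : FinDimRep G) : FinDimRep G where
  ι := u.ι × v.ι
  mat := u.mat ⊗ₖ v.mat
  mem_unitary := by
    have hu := Unitary.mem_iff.1 u.mem_unitary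
    have hv := Unitary.mem_iff.1 v.mem_unitary
    simp only [Matrix.star_eq_conjTranspose, ← Matrix.ext_iff, Matrix.mul_apply,
      Matrix.conjTranspose_apply] at hu hv
    rw [Unitary.mem_iff]
    constructor
    · ext ⟨i, k⟩ ⟨j, l⟩
      have h : ∀ a b, star (v.mat b k) * star (u.mat a i) * (u.mat a j * v.mat b l) =
          star (v.mat b k) * (star (u.mat a i) * u.mat a j) * v.mat b l := fun a b => by
        simp only [mul_assoc]
      simp only [Matrix.star_eq_conjTranspose, Matrix.mul_apply, Matrix.conjTranspose_apply,
        Matrix.kroneckerMap_apply, star_mul, Fintype.sum_prod_type_right, h, ← Finset.sum_mul,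
        ← Finset.mul_sum, hu.1 i j]
      by_cases hij : i = j
      · simp [hij, hv.1 k l, Matrix.one_apply]
      · simp [hij]
    · ext ⟨i, k⟩ ⟨j, l⟩
      have h : ∀ a b, u.mat i a * v.mat k b * (star (v.mat l b) * star (u.mat j a)) =
          u.mat i a * (v.mat k b * star (v.mat l b)) * star (u.mat j a) := fun a b => by
        simp only [mul_assoc]
      simp only [Matrix.star_eq_conjTranspose, Matrix.mul_apply, Matrix.conjTranspose_apply,
        Matrix.kroneckerMap_apply, star_mul, Fintype.sum_prod_type, h, ← Finset.sum_mul,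
        ← Finset.mul_sum, hv.2 k l]
      by_cases hkl : k = l
      · simp [hkl, hu.2 i j, Matrix.one_apply]
      · simp [hkl]
  comul_mat := by
    rintro ⟨i, k⟩ ⟨j, l⟩
    simp only [Matrix.kroneckerMap_apply, map_mul, u.comul_mat, v.comul_mat,
      Finset.sum_mul_sum, Fintype.sum_prod_type, ← Algebra.TensorProduct.tmul_mul_tmul]

/-- The tensor powers of a representation. -/
def tensorPow (u : FinDimRep G) : ℕ → FinDimRep G
  | 0 => trivial G
  | n + 1 => tensor (tensorPow u n) u

/-- `w` is isomorphic to a subrepresentation of `u`: there is an isometric intertwiner. -/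
def IsSubrep (w u : FinDimRep G) : Prop :=
  ∃ T : Matrix u.ι w.ι ℂ, Intertwines w u T ∧ T.conjTranspose * T = 1

/-- `u` is irreducible: it is nonzero and has no subrepresentations but zero and itself. -/
def IsIrreducible (u : FinDimRep G) : Prop :=
  0 < Fintype.card u.ι ∧
    ∀ w : FinDimRep G, IsSubrep w u → Fintype.card w.ι = 0 ∨ Fintype.card w.ι = Fintype.card u.ι

/-- The unitary representation `v` is a conjugate (dual) of `u`: it is equivalent, through an
invertible complex matrix, to the matrix of the adjoints `(u_ij)⋆` (which need not be unitary). -/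
def IsConjugate (u v : FinDimRep G) : Prop :=
  ∃ (T : Matrix v.ι u.ι ℂ) (S : Matrix u.ι v.ι ℂ),
    scalar G T * u.mat.map star = v.mat * scalar G T ∧ S * T = 1 ∧ T * S = 1

instance setoid (G : CompactQuantumGroup.{u}) : Setoid (FinDimRep G) where
  r := Equivalent
  iseqv := ⟨Equivalent.refl, Equivalent.symm, Equivalent.trans⟩

theorem Equivalent.directSum {u u' v v' : FinDimRep G} (h : Equivalent u u')
    (h' : Equivalent v v') : Equivalent (u.directSum v) (u'.directSum v') := by
  obtain ⟨T, S, hT, h1, h2⟩ := h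
  obtain ⟨T', S', hT', h1', h2'⟩ := h'
  refine ⟨Matrix.fromBlocks T 0 0 T', Matrix.fromBlocks S 0 0 S', ?_, ?_, ?_⟩
  · have hs : scalar G (Matrix.fromBlocks T 0 0 T') =
        Matrix.fromBlocks (scalar G T) 0 0 (scalar G T') := by
      simp [scalar, Matrix.fromBlocks_map]
    unfold Intertwines at *
    erw [hs]
    simp only [FinDimRep.directSum]
    erw [Matrix.fromBlocks_multiply, Matrix.fromBlocks_multiply]
    simp [hT, hT']
  · erw [Matrix.fromBlocks_multiply]
    simp [h1, h1']
    rfl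
  · erw [Matrix.fromBlocks_multiply]
    simp [h2, h2']
    rfl

open scoped Kronecker in
theorem Equivalent.tensor {u u' v v' : FinDimRep G} (h : Equivalent u u')
    (h' : Equivalent v v') : Equivalent (u.tensor v) (u'.tensor v') := by
  obtain ⟨T, S, hT, h1, h2⟩ := h
  obtain ⟨T', S', hT', h1', h2'⟩ := h'
  refine ⟨T ⊗ₖ T', S ⊗ₖ S', ?_, ?_, ?_⟩
  · simp only [Intertwines, ← Matrix.ext_iff, Matrix.mul_apply, scalar, Matrix.map_apply] at hT hT'
    unfold Intertwines
    ext ⟨i, k⟩ ⟨j, l⟩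
    have e1 : ∀ a b, algebraMap ℂ G.alg (T i a * T' k b) * (u.mat a j * v.mat b l) =
        (algebraMap ℂ G.alg (T i a) * u.mat a j) * (algebraMap ℂ G.alg (T' k b) * v.mat b l) := by
      intro a b
      rw [map_mul, mul_assoc, mul_assoc, ← mul_assoc (algebraMap ℂ G.alg (T' k b)),
        Algebra.commutes (T' k b) (u.mat a j), mul_assoc]
    have e2 : ∀ a b, u'.mat i a * v'.mat k b * algebraMap ℂ G.alg (T a j * T' b l) =
        (u'.mat i a * algebraMap ℂ G.alg (T a j)) * (v'.mat k b * algebraMap ℂ G.alg (T' b l)) := by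
      intro a b
      rw [map_mul, mul_assoc, mul_assoc, ← mul_assoc (v'.mat k b),
        ← Algebra.commutes (T a j) (v'.mat k b), mul_assoc]
    change ∑ p : u.ι × v.ι, algebraMap ℂ G.alg (T i p.1 * T' k p.2) * (u.mat p.1 j * v.mat p.2 l)
      = ∑ p : u'.ι × v'.ι, u'.mat i p.1 * v'.mat k p.2 * algebraMap ℂ G.alg (T p.1 j * T' p.2 l)
    simp only [e1, e2, Fintype.sum_prod_type, ← Finset.sum_mul_sum, hT, hT']
  · change (S ⊗ₖ S') * (T ⊗ₖ T') = 1
    rw [← Matrix.mul_kronecker_mul, h1, h1', Matrix.one_kronecker_one]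
  · change (T ⊗ₖ T') * (S ⊗ₖ S') = 1
    rw [← Matrix.mul_kronecker_mul, h2, h2', Matrix.one_kronecker_one]

end FinDimRep

/-- The isomorphism classes of finite-dimensional representations of `G`. -/
def RepClass (G : CompactQuantumGroup.{u}) : Type (max u 1) := Quotient (FinDimRep.setoid G)

namespace RepClass

variable {G : CompactQuantumGroup.{u}}

/-- The isomorphism class of a representation. -/
def mk (u : FinDimRep G) : RepClass G := Quotient.mk _ u

instance : Zero (RepClass G) := ⟨mk (.zero G)⟩
instance : One (RepClass G) := ⟨mk (.trivial G)⟩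
instance : Add (RepClass G) :=
  ⟨Quotient.map₂ FinDimRep.directSum fun _ _ h _ _ h' => h.directSum h'⟩
instance : Mul (RepClass G) :=
  ⟨Quotient.map₂ FinDimRep.tensor fun _ _ h _ _ h' => h.tensor h'⟩

theorem mk_eq_of_equiv {u v : FinDimRep G} (e : u.ι ≃ v.ι)
    (h : ∀ i j, u.mat i j = v.mat (e i) (e j)) : mk u = mk v :=
  Quotient.sound (FinDimRep.equivalent_of_equiv e h)

/-- Isomorphism classes form a semiring under direct sum and tensor product. -/
instance : Semiring (RepClass G) where
  nsmul := nsmulRec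
  npow := npowRec
  natCast := Nat.unaryCast
  add_assoc := by
    rintro ⟨u⟩ ⟨v⟩ ⟨w⟩
    exact mk_eq_of_equiv (Equiv.sumAssoc _ _ _) (by rintro ((i | i) | i) ((j | j) | j) <;> rfl)
  zero_add := by
    rintro ⟨u⟩
    exact mk_eq_of_equiv (Equiv.emptySum Empty _) (by rintro (⟨⟨⟩⟩ | i) (⟨⟨⟩⟩ | j); rfl)
  add_zero := by
    rintro ⟨u⟩
    exact mk_eq_of_equiv (Equiv.sumEmpty _ Empty) (by rintro (i | ⟨⟨⟩⟩) (j | ⟨⟨⟩⟩); rfl)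
  add_comm := by
    rintro ⟨u⟩ ⟨v⟩
    exact mk_eq_of_equiv (Equiv.sumComm _ _) (by rintro (i | i) (j | j) <;> rfl)
  mul_assoc := by
    rintro ⟨u⟩ ⟨v⟩ ⟨w⟩
    exact mk_eq_of_equiv (Equiv.prodAssoc _ _ _)
      (by rintro ⟨⟨i, j⟩, k⟩ ⟨⟨i', j'⟩, k'⟩; exact mul_assoc _ _ _)
  one_mul := by
    rintro ⟨u⟩
    exact mk_eq_of_equiv (Equiv.punitProd _) (by rintro ⟨⟨⟩, i⟩ ⟨⟨⟩, j⟩; exact one_mul _)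
  mul_one := by
    rintro ⟨u⟩
    exact mk_eq_of_equiv (Equiv.prodPUnit _) (by rintro ⟨i, ⟨⟩⟩ ⟨j, ⟨⟩⟩; exact mul_one _)
  left_distrib := by
    rintro ⟨u⟩ ⟨v⟩ ⟨w⟩
    refine mk_eq_of_equiv (Equiv.prodSumDistrib _ _ _) ?_
    rintro ⟨i, (k | k)⟩ ⟨j, (l | l)⟩
    · rfl
    · exact mul_zero _
    · exact mul_zero _
    · rfl
  right_distrib := by
    rintro ⟨u⟩ ⟨v⟩ ⟨w⟩
    refine mk_eq_of_equiv (Equiv.sumProdDistrib _ _ _) ?_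
    rintro ⟨(k | k), i⟩ ⟨(l | l), j⟩
    · rfl
    · exact zero_mul _
    · exact zero_mul _
    · rfl
  zero_mul := by
    rintro ⟨u⟩
    exact mk_eq_of_equiv (Equiv.equivOfIsEmpty (Empty × _) Empty) (by rintro ⟨⟨⟩, _⟩)
  mul_zero := by
    rintro ⟨u⟩
    exact mk_eq_of_equiv (Equiv.equivOfIsEmpty (_ × Empty) Empty) (by rintro ⟨_, ⟨⟩⟩)

end RepClass

/-- The Grothendieck (fusion) ring `Rep G`: the group of formal differences of isomorphism classes of
finite-dimensional representations (addition is the direct sum), with the product that is induced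
by the tensor product. -/
def RepRing (G : CompactQuantumGroup.{u}) : Type (max u 1) :=
  Algebra.GrothendieckAddGroup (RepClass G)

namespace RepRing

variable {G : CompactQuantumGroup.{u}}

instance : AddCommGroup (RepRing G) :=
  inferInstanceAs (AddCommGroup (Algebra.GrothendieckAddGroup (RepClass G)))

/-- The element of `Rep G` given by an isomorphism class. -/
def of : RepClass G →+ RepRing G := Algebra.GrothendieckAddGroup.of

theorem of_eq_of_iff {a b : RepClass G} : of a = of b ↔ ∃ c, c + a = c + b := by
  refine ((AddLocalization.addMonoidOf (⊤ : AddSubmonoid (RepClass G))).eq_iff_exists).trans ?_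
  exact ⟨fun ⟨c, h⟩ => ⟨c, h⟩, fun ⟨c, h⟩ => ⟨⟨c, trivial⟩, h⟩⟩

theorem exists_eq_sub (x : RepRing G) : ∃ a b, x = of a - of b := by
  induction x using AddLocalization.ind with
  | H y =>
    refine ⟨y.1, y.2, eq_sub_of_add_eq ?_⟩
    exact ((AddLocalization.addMonoidOf (⊤ : AddSubmonoid (RepClass G))).eq_mk'_iff_add_eq).1
      (AddLocalization.mk_eq_addMonoidOf_mk'_apply y.1 y.2)

theorem addHom_ext {M : Type*} [AddCommGroup M] {f g : RepRing G →+ M}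
    (h : ∀ a, f (of a) = g (of a)) : f = g := by
  ext x
  obtain ⟨a, b, rfl⟩ := exists_eq_sub x
  simp [h]

/-- The universal property of the Grothendieck group. -/
def lift {M : Type*} [AddCommGroup M] (f : RepClass G →+ M) : RepRing G →+ M :=
  Algebra.GrothendieckAddGroup.lift f

@[simp] theorem lift_of {M : Type*} [AddCommGroup M] (f : RepClass G →+ M) (a : RepClass G) :
    lift f (of a) = f a :=
  DFunLike.congr_fun (Algebra.GrothendieckAddGroup.lift.symm_apply_apply f) a

/-- The biadditive extension of the tensor product to `Rep G`. -/
def mulHom : RepRing G →+ RepRing G →+ RepRing G :=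
  lift
    { toFun := fun a => lift (of.comp (AddMonoidHom.mulLeft a))
      map_zero' := addHom_ext fun b => by simp
      map_add' := fun a a' => addHom_ext fun b => by simp [add_mul] }

instance : Mul (RepRing G) := ⟨fun x y => mulHom x y⟩
instance : One (RepRing G) := ⟨of 1⟩

theorem mul_def (x y : RepRing G) : x * y = mulHom x y := rfl

@[simp] theorem of_mul (a b : RepClass G) : of (a * b) = of a * of b := by
  simp [mul_def, mulHom]

@[simp] theorem of_one : of (1 : RepClass G) = 1 := rfl

protected theorem mul_add (x y z : RepRing G) : x * (y + z) = x * y + x * z := by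
  simp [mul_def]

protected theorem add_mul (x y z : RepRing G) : (x + y) * z = x * z + y * z := by
  simp [mul_def]

protected theorem mul_sub (x y z : RepRing G) : x * (y - z) = x * y - x * z := by
  simp [mul_def]

protected theorem sub_mul (x y z : RepRing G) : (x - y) * z = x * z - y * z := by
  simp [mul_def]

instance : Ring (RepRing G) where
  __ := (inferInstance : AddCommGroup (RepRing G))
  npow := npowRec
  natCast := Nat.unaryCast
  left_distrib := RepRing.mul_add
  right_distrib := RepRing.add_mul
  zero_mul x := by simp [mul_def]
  mul_zero x := by simp [mul_def]
  one_mul x := by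
    obtain ⟨a, b, rfl⟩ := exists_eq_sub x
    rw [RepRing.mul_sub, ← of_one, ← of_mul, ← of_mul, one_mul, one_mul]
  mul_one x := by
    obtain ⟨a, b, rfl⟩ := exists_eq_sub x
    rw [RepRing.sub_mul, ← of_one, ← of_mul, ← of_mul, mul_one, mul_one]
  mul_assoc x y z := by
    obtain ⟨a, b, rfl⟩ := exists_eq_sub x
    obtain ⟨c, d, rfl⟩ := exists_eq_sub y
    obtain ⟨e, f, rfl⟩ := exists_eq_sub z
    simp only [RepRing.sub_mul, RepRing.mul_sub, ← of_mul, mul_assoc]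

end RepRing

/-- The canonical Hopf ⋆-algebra `Q_G` of `G`: the ⋆-subalgebra of `Q` generated by the matrix
coefficients of the finite-dimensional unitary representations. The linear span of these
coefficients contains `1` and is closed under products (tensor products of representations) and
adjoints (conjugate representations), so `Q_G` is this linear span. -/
def coord (G : CompactQuantumGroup.{u}) : StarSubalgebra ℂ G.alg :=
  StarAlgebra.adjoin ℂ {x | ∃ (u : FinDimRep G) (i j : u.ι), x = u.mat i j}

section coord

variable (G : CompactQuantumGroup.{u})

theorem mat_mem_coord {G : CompactQuantumGroup.{u}} (u : FinDimRep G) (i j : u.ι) :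
    u.mat i j ∈ G.coord :=
  StarAlgebra.subset_adjoin ℂ _ ⟨u, i, j, rfl⟩

/-- The inclusion of the algebraic tensor product of `Q_G` with itself into the operators on
`H ⊗ H`. -/
def coordTensor : G.coord ⊗[ℂ] G.coord →⋆ₐ[ℂ]
    (HilbertTensor G.space G.space →L[ℂ] HilbertTensor G.space G.space) :=
  tensorRep (G.rep.comp G.coord.subtype) (G.rep.comp G.coord.subtype)

theorem coordTensor_injective : Function.Injective G.coordTensor :=
  tensorRep_injective (G.rep_injective.comp Subtype.val_injective)
    (G.rep_injective.comp Subtype.val_injective)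

/-- The coproduct `Δ`, restricted to `Q_G`, with values in the operators on `H ⊗ H`. -/
def comulCoordAux : G.coord →⋆ₐ[ℂ]
    (HilbertTensor G.space G.space →L[ℂ] HilbertTensor G.space G.space) :=
  ((minTensor G.rep G.rep).subtype.comp G.comul).comp G.coord.subtype

theorem comulCoordAux_mat {G : CompactQuantumGroup.{u}} (u : FinDimRep G) (i j : u.ι) :
    G.comulCoordAux ⟨u.mat i j, mat_mem_coord u i j⟩ = G.coordTensor
      (∑ k, (⟨u.mat i k, mat_mem_coord u i k⟩ : G.coord) ⊗ₜ ⟨u.mat k j, mat_mem_coord u k j⟩) := by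
  change (G.comul (u.mat i j)).1 = _
  rw [u.comul_mat, map_sum]
  exact map_sum (minTensor G.rep G.rep).subtype _ _

variable {G} in
theorem coord_induction {p : G.coord → Prop}
    (mat : ∀ (u : FinDimRep G) (i j : u.ι), p ⟨u.mat i j, mat_mem_coord u i j⟩)
    (algebraMap : ∀ r : ℂ, p (algebraMap ℂ G.coord r))
    (add : ∀ x y, p x → p y → p (x + y)) (mul : ∀ x y, p x → p y → p (x * y))
    (star : ∀ x, p x → p (star x)) (x : G.coord) : p x :=
  StarAlgebra.adjoin_induction_subtype (p := p) x
    (fun _ ⟨u, i, j, h⟩ => by subst h; exact mat u i j) algebraMap add mul star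

theorem comulCoordAux_mem_range (x : G.coord) : G.comulCoordAux x ∈ G.coordTensor.range := by
  refine coord_induction (p := fun x => G.comulCoordAux x ∈ G.coordTensor.range) ?_ ?_ ?_ ?_ ?_ x
  · exact fun u i j => (AlgHom.mem_range _).2 ⟨_, (comulCoordAux_mat u i j).symm⟩
  · intro r
    rw [show G.comulCoordAux (algebraMap ℂ _ r) = _ from AlgHomClass.commutes G.comulCoordAux r]
    exact algebraMap_mem _ r
  · intro x y hx hy
    rw [map_add]
    exact add_mem hx hy
  · intro x y hx hy
    rw [map_mul]
    exact mul_mem hx hy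
  · intro x hx
    rw [map_star]
    exact star_mem hx

/-- The comultiplication of the Hopf ⋆-algebra `Q_G`, with values in the algebraic tensor product:
the restriction of `Δ`. -/
def coordComul : G.coord →⋆ₐ[ℂ] G.coord ⊗[ℂ] G.coord :=
  ((StarAlgEquiv.ofInjective G.coordTensor G.coordTensor_injective).symm :
      G.coordTensor.range →⋆ₐ[ℂ] G.coord ⊗[ℂ] G.coord).comp
    (G.comulCoordAux.codRestrict _ G.comulCoordAux_mem_range)

theorem coordTensor_coordComul (x : G.coord) :
    G.coordTensor (G.coordComul x) = (G.comul x : minTensor G.rep G.rep).1 :=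
  congrArg Subtype.val
    ((StarAlgEquiv.ofInjective G.coordTensor G.coordTensor_injective).apply_symm_apply
      (G.comulCoordAux.codRestrict _ G.comulCoordAux_mem_range x))

theorem coordComul_mat {G : CompactQuantumGroup.{u}} (u : FinDimRep G) (i j : u.ι) :
    G.coordComul ⟨u.mat i j, mat_mem_coord u i j⟩ =
      ∑ k, (⟨u.mat i k, mat_mem_coord u i k⟩ : G.coord) ⊗ₜ ⟨u.mat k j, mat_mem_coord u k j⟩ :=
  G.coordTensor_injective ((G.coordTensor_coordComul _).trans (comulCoordAux_mat u i j))

end coord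

/-- `u` is a torsion representation: up to isomorphism only finitely many irreducible representations
occur in the tensor powers of `u ⊕ v`, where `v` is the conjugate of `u`. -/
def FinDimRep.IsTorsion {G : CompactQuantumGroup.{u}} (u : FinDimRep G) : Prop :=
  ∃ v : FinDimRep G, u.IsConjugate v ∧
    {c : RepClass G | ∃ w : FinDimRep G, RepClass.mk w = c ∧ w.IsIrreducible ∧
      ∃ n : ℕ, w.IsSubrep ((u.directSum v).tensorPow n)}.Finite

/-- `G` is connected: it has no nontrivial torsion irreducible representation. -/
def IsConnected (G : CompactQuantumGroup.{u}) : Prop :=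
  ∀ u : FinDimRep G, u.IsIrreducible → u.IsTorsion → u.Equivalent (FinDimRep.trivial G)

/-- `G` is irreducible: `Q_G` is a (possibly noncommutative) domain. -/
def IsIrreducible (G : CompactQuantumGroup.{u}) : Prop := IsDomain G.coord

/-- `G` is weakly irreducible: `Rep G` is a (possibly noncommutative) domain. -/
def IsWeaklyIrreducible (G : CompactQuantumGroup.{u}) : Prop := IsDomain (RepRing G)

universe v w

/-- A morphism `G → K` of compact quantum groups: a homomorphism `Q_K → Q_G` of Hopf ⋆-algebras.
(A unital homomorphism compatible with the comultiplications is automatically compatible with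
counits and antipodes.) -/
structure Hom (G : CompactQuantumGroup.{u}) (K : CompactQuantumGroup.{v}) where
  /-- The homomorphism of coordinate algebras. -/
  pullback : K.coord →⋆ₐ[ℂ] G.coord
  map_comul : ∀ x : K.coord,
    TensorProduct.map pullback.toLinearMap pullback.toLinearMap (K.coordComul x) =
      G.coordComul (pullback x)

/-- An inverse system of compact quantum groups, with morphisms `G_j → G_i` for `i ≤ j`. -/
structure InverseSystem (I : Type w) [Preorder I] where
  /-- The compact quantum groups `G_i`. -/
  obj : I → CompactQuantumGroup.{u}
  /-- The transition morphisms `G_j → G_i`. -/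
  map : ∀ {i j : I}, i ≤ j → Hom (obj j) (obj i)
  map_refl : ∀ (i : I) (x : (obj i).coord), (map (le_refl i)).pullback x = x
  map_comp : ∀ {i j k : I} (hij : i ≤ j) (hjk : j ≤ k) (x : (obj i).coord),
    (map hjk).pullback ((map hij).pullback x) = (map (hij.trans hjk)).pullback x

/-- `G`, with the morphisms `proj i : G → G_i`, is the inverse limit of the inverse system `(G_i)`:
the Hopf ⋆-algebra `Q_G` is the direct limit of the `Q_{G_i}`. -/
structure IsInverseLimit {I : Type w} [Preorder I] (S : InverseSystem.{u} I)
    (G : CompactQuantumGroup.{v}) (proj : ∀ i, Hom G (S.obj i)) : Prop where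
  compatible : ∀ {i j : I} (hij : i ≤ j) (x : (S.obj i).coord),
    (proj j).pullback ((S.map hij).pullback x) = (proj i).pullback x
  jointly_surjective : ∀ y : G.coord, ∃ (i : I) (x : (S.obj i).coord), (proj i).pullback x = y
  eventually_zero : ∀ (i : I) (x : (S.obj i).coord), (proj i).pullback x = 0 →
    ∃ (j : I) (hij : i ≤ j), (S.map hij).pullback x = 0

end CompactQuantumGroup

end

/-! Everything rests on a finiteness principle: an element of `Q_G` comes from some stage, and a
finite system of equations between elements of one stage that holds in `Q_G` already holds at a
later stage. A unitary representation is a finite matrix subject to finitely many equations, so each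
representation of `G` is the pullback of one at some stage (`exists_pull_eq`). The comultiplication
equations live in `Q ⊗ Q`, which requires descent of tensor identities (`exists_tensorMap_eq_zero`).
Intertwiners are complex matrices, untouched by pullback, so equivalences and conjugacy descend as
well (`exists_map_eq`, `exists_isConjugate_pull`).

For irreducibility, a vanishing product in `Q_G` vanishes at some stage, where one factor must be
zero. For weak irreducibility, a vanishing product in `Rep G` amounts to one equality between
classes of actual representations, which also descends.

For connectedness, let `u` be torsion irreducible with conjugate `v`, and let `C` be the finite set
of irreducible classes in the powers of `u ⊕ v`. Multiplication by `u ⊕ v` maps sums of members of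
`C` to such sums, by complete reducibility (`exists_eq_sum_isIrreducible`). This finite fusion table
descends to a stage, together with the conjugacy. There the powers of the lifted `u ⊕ v` are sums of
lifts of members of `C`; these lifts are irreducible, since irreducibility of a pullback implies
irreducibility. By Schur's lemma (`Intertwines.mk_mem_of_eq_sum`) nothing else occurs, so the lift
of `u` is torsion, hence trivial, and so is `u`. -/

/-! ### Tensor linear algebra and finite families over a directed set. -/

/-- Over a field, the kernel hypotheses make `g` factor as `φ ∘ f` on `M` and as `ψ ∘ f` on `N`;
hence `g ⊗ g` equals `(φ ⊗ ψ) ∘ (f ⊗ f)` on the image of `M ⊗ N`. -/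
theorem TensorProduct.map_map_eq_zero_of_mem_range_mapIncl {𝕜 A B C : Type*} [Field 𝕜]
    [AddCommGroup A] [AddCommGroup B] [AddCommGroup C] [Module 𝕜 A] [Module 𝕜 B] [Module 𝕜 C]
    (f : A →ₗ[𝕜] B) (g : A →ₗ[𝕜] C) {M N : Submodule 𝕜 A}
    (hM : ∀ x ∈ M, f x = 0 → g x = 0) (hN : ∀ x ∈ N, f x = 0 → g x = 0) {t : A ⊗[𝕜] A}
    (ht : t ∈ LinearMap.range (TensorProduct.mapIncl M N)) (h : TensorProduct.map f f t = 0) :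
    TensorProduct.map g g t = 0 := by
  have factor : ∀ P : Submodule 𝕜 A, (∀ x ∈ P, f x = 0 → g x = 0) →
      ∃ φ : B →ₗ[𝕜] C, g ∘ₗ P.subtype = φ ∘ₗ f ∘ₗ P.subtype := by
    intro P hP
    let k : P →ₗ[𝕜] B := f ∘ₗ P.subtype
    obtain ⟨r, hr⟩ := LinearMap.exists_leftInverse_of_injective
      (k.ker.liftQ k le_rfl) (Submodule.ker_liftQ_eq_bot' _ _ rfl)
    have hk : k.ker ≤ (g ∘ₗ P.subtype).ker := fun x hx => hP x x.2 hx
    refine ⟨k.ker.liftQ (g ∘ₗ P.subtype) hk ∘ₗ r, ?_⟩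
    ext x
    have := LinearMap.congr_fun hr (k.ker.mkQ x)
    simp only [LinearMap.comp_apply, Submodule.mkQ_apply, Submodule.liftQ_apply,
      LinearMap.id_apply] at this
    change _ = k.ker.liftQ _ hk (r (k x))
    rw [this]
    rfl
  obtain ⟨φ, hφ⟩ := factor M hM
  obtain ⟨ψ, hψ⟩ := factor N hN
  obtain ⟨s, rfl⟩ := ht
  have e : TensorProduct.map g g (TensorProduct.mapIncl M N s) =
      TensorProduct.map φ ψ (TensorProduct.map f f (TensorProduct.mapIncl M N s)) := by
    simp only [TensorProduct.mapIncl, ← LinearMap.comp_apply, ← TensorProduct.map_comp, hφ, hψ]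
  rw [e, h, map_zero]

theorem exists_ge_forall_of_finite {I : Type*} [Preorder I] [IsDirectedOrder I] {i : I}
    {κ : Type*} [Finite κ] {P : κ → ∀ j, i ≤ j → Prop}
    (mono : ∀ k j l (hij : i ≤ j) (hjl : j ≤ l), P k j hij → P k l (hij.trans hjl))
    (h : ∀ k, ∃ j hij, P k j hij) : ∃ j hij, ∀ k, P k j hij := by
  have : Nonempty I := ⟨i⟩
  choose j hij hP using h
  obtain ⟨M, hM⟩ := Finite.exists_le j
  -- For empty `κ` the bound `M` need not lie above `i`.
  obtain ⟨l, hil, hMl⟩ := exists_ge_ge i M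
  exact ⟨l, hil, fun k => mono k (j k) l (hij k) ((hM k).trans hMl) (hP k)⟩

noncomputable section

namespace CompactQuantumGroup

universe u v w

open scoped Matrix

/-! ### Intertwiners and subrepresentations. -/

namespace FinDimRep

variable {G : CompactQuantumGroup.{u}}

theorem conjTranspose_mat_mul (u : FinDimRep G) : u.matᴴ * u.mat = 1 :=
  (Unitary.mem_iff.1 u.mem_unitary).1

theorem mat_mul_conjTranspose (u : FinDimRep G) : u.mat * u.matᴴ = 1 :=
  (Unitary.mem_iff.1 u.mem_unitary).2

theorem scalar_conjTranspose {m n : Type} (T : Matrix m n ℂ) :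
    (scalar G T)ᴴ = scalar G Tᴴ := by
  ext i j
  exact (algebraMap_star_comm (T j i)).symm

theorem Intertwines.comp {u v w : FinDimRep G} {T : Matrix v.ι u.ι ℂ} {T' : Matrix w.ι v.ι ℂ}
    (hT' : Intertwines v w T') (hT : Intertwines u v T) : Intertwines u w (T' * T) := by
  unfold Intertwines at *
  rw [scalar_mul, Matrix.mul_assoc, hT, ← Matrix.mul_assoc, hT', Matrix.mul_assoc]

/-- Taking adjoints in `T u = v T` gives `u* T* = T* v*`; multiply by `u` on the left and `v` on the
right and use unitarity. -/
theorem Intertwines.conjTranspose {u v : FinDimRep G} {T : Matrix v.ι u.ι ℂ}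
    (h : Intertwines u v T) : Intertwines v u Tᴴ := by
  have h' := congrArg (fun A => u.mat * Matrix.conjTranspose A * v.mat) h
  simp only [Matrix.conjTranspose_mul, scalar_conjTranspose] at h'
  rw [← Matrix.mul_assoc, mat_mul_conjTranspose, Matrix.one_mul, Matrix.mul_assoc u.mat,
    Matrix.mul_assoc (scalar G Tᴴ), conjTranspose_mat_mul, Matrix.mul_one] at h'
  exact h'

/-- The product of two matrices over `Q`, with entries multiplied in `Q ⊗ Q`. -/
def tmulMat {l m n : Type} [Fintype m] (A : Matrix l m G.alg) (B : Matrix m n G.alg) :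
    Matrix l n (G.alg ⊗[ℂ] G.alg) :=
  Matrix.of fun i j => ∑ k, A i k ⊗ₜ B k j

/-- The tensor product is balanced over `ℂ`. This lets projections move between the two legs in the
coproduct of a compressed representation. -/
theorem tmulMat_scalar {l m m' n : Type} [Fintype m] [Fintype m'] (A : Matrix l m G.alg)
    (T : Matrix m m' ℂ) (B : Matrix m' n G.alg) :
    tmulMat (A * scalar G T) B = tmulMat A (scalar G T * B) := by
  ext i j
  simp only [tmulMat, Matrix.of_apply, Matrix.mul_apply, scalar, Matrix.map_apply,
    TensorProduct.sum_tmul, TensorProduct.tmul_sum]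
  rw [Finset.sum_comm]
  refine Finset.sum_congr rfl fun k _ => Finset.sum_congr rfl fun k' _ => ?_
  rw [← Algebra.commutes, ← Algebra.smul_def, ← Algebra.smul_def, TensorProduct.smul_tmul]

theorem map_comul_mat (u : FinDimRep G) :
    u.mat.map G.comul = (tmulMat u.mat u.mat).map G.algTensor := by
  ext1 i j
  simp [tmulMat, u.comul_mat]

theorem map_comul_scalar {m n : Type} (T : Matrix m n ℂ) :
    (scalar G T).map G.comul = (T.map (algebraMap ℂ (G.alg ⊗[ℂ] G.alg))).map G.algTensor := by
  ext1 i j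
  exact (AlgHomClass.commutes G.comul _).trans (AlgHomClass.commutes G.algTensor _).symm

theorem algebraMap_mul_tmulMat {l m n k : Type} [Fintype m] [Fintype n]
    (T : Matrix l m ℂ) (A : Matrix m n G.alg) (B : Matrix n k G.alg) :
    T.map (algebraMap ℂ (G.alg ⊗[ℂ] G.alg)) * tmulMat A B = tmulMat (scalar G T * A) B := by
  ext i j
  simp only [tmulMat, Matrix.of_apply, Matrix.mul_apply, scalar, Matrix.map_apply,
    TensorProduct.sum_tmul, Finset.mul_sum]
  rw [Finset.sum_comm]
  simp only [← Algebra.smul_def, TensorProduct.smul_tmul']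

theorem tmulMat_mul_algebraMap {l m n k : Type} [Fintype m] [Fintype n]
    (A : Matrix l m G.alg) (B : Matrix m n G.alg) (T : Matrix n k ℂ) :
    tmulMat A B * T.map (algebraMap ℂ (G.alg ⊗[ℂ] G.alg)) = tmulMat A (B * scalar G T) := by
  ext i j
  simp only [tmulMat, Matrix.of_apply, Matrix.mul_apply, scalar, Matrix.map_apply,
    TensorProduct.tmul_sum, Finset.sum_mul]
  rw [Finset.sum_comm]
  simp only [← Algebra.commutes, ← Algebra.smul_def, TensorProduct.tmul_smul]

/-- The subrepresentation of `u` on the range of an isometry whose range projection is an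
endomorphism of `u`. -/
def restrict (u : FinDimRep G) {κ : Type} [Fintype κ] [DecidableEq κ] (S : Matrix u.ι κ ℂ)
    (hS : Sᴴ * S = 1) (hu : Intertwines u u (S * Sᴴ)) : FinDimRep G where
  ι := κ
  mat := scalar G Sᴴ * u.mat * scalar G S
  mem_unitary := by
    have h1 : scalar G Sᴴ * scalar G S = 1 := by rw [← scalar_mul, hS, scalar_one]
    have h2 : scalar G S * scalar G Sᴴ * u.mat = u.mat * (scalar G S * scalar G Sᴴ) := by
      rw [← scalar_mul]; exact hu
    have h3 : u.matᴴ * (scalar G S * scalar G Sᴴ) = scalar G S * scalar G Sᴴ * u.matᴴ := by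
      have := congrArg Matrix.conjTranspose h2
      simpa only [Matrix.conjTranspose_mul, scalar_conjTranspose,
        Matrix.conjTranspose_conjTranspose] using this
    rw [Unitary.mem_iff, Matrix.star_eq_conjTranspose]
    simp only [Matrix.conjTranspose_mul, scalar_conjTranspose, Matrix.conjTranspose_conjTranspose]
    constructor
    · calc scalar G Sᴴ * (u.matᴴ * scalar G S) * (scalar G Sᴴ * u.mat * scalar G S)
          = scalar G Sᴴ * (u.matᴴ * (scalar G S * scalar G Sᴴ * u.mat)) * scalar G S := by
            simp only [Matrix.mul_assoc]
        _ = scalar G Sᴴ * (u.matᴴ * u.mat * (scalar G S * scalar G Sᴴ)) * scalar G S := by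
            rw [h2, Matrix.mul_assoc u.matᴴ]
        _ = scalar G Sᴴ * scalar G S * (scalar G Sᴴ * scalar G S) := by
            rw [conjTranspose_mat_mul, Matrix.one_mul]; simp only [Matrix.mul_assoc]
        _ = 1 := by rw [h1, Matrix.one_mul]
    · calc scalar G Sᴴ * u.mat * scalar G S * (scalar G Sᴴ * (u.matᴴ * scalar G S))
          = scalar G Sᴴ * (u.mat * (scalar G S * scalar G Sᴴ * u.matᴴ)) * scalar G S := by
            simp only [Matrix.mul_assoc]
        _ = scalar G Sᴴ * (u.mat * u.matᴴ * (scalar G S * scalar G Sᴴ)) * scalar G S := by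
            rw [← h3, Matrix.mul_assoc u.mat]
        _ = scalar G Sᴴ * scalar G S * (scalar G Sᴴ * scalar G S) := by
            rw [mat_mul_conjTranspose, Matrix.one_mul]; simp only [Matrix.mul_assoc]
        _ = 1 := by rw [h1, Matrix.one_mul]
  comul_mat := by
    have h1 : scalar G Sᴴ * scalar G S = 1 := by rw [← scalar_mul, hS, scalar_one]
    have h2 : scalar G (S * Sᴴ) * u.mat = u.mat * scalar G (S * Sᴴ) := hu
    have h3 : scalar G Sᴴ * u.mat * scalar G (S * Sᴴ) = scalar G Sᴴ * u.mat := by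
      rw [Matrix.mul_assoc, ← h2, scalar_mul, ← Matrix.mul_assoc, ← Matrix.mul_assoc, h1,
        Matrix.one_mul]
    have key : (scalar G Sᴴ * u.mat * scalar G S).map G.comul =
        (tmulMat (scalar G Sᴴ * u.mat * scalar G S)
          (scalar G Sᴴ * u.mat * scalar G S)).map G.algTensor := by
      -- The inner factors `S` and `S*` combine to the projection `S S*`, which crosses to the left
      -- leg and is absorbed there by `h3`.
      have e : tmulMat (scalar G Sᴴ * u.mat * scalar G S) (scalar G Sᴴ * u.mat * scalar G S) =
          tmulMat (scalar G Sᴴ * u.mat) (u.mat * scalar G S) := by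
        rw [tmulMat_scalar, Matrix.mul_assoc, ← Matrix.mul_assoc (scalar G S), ← scalar_mul,
          ← tmulMat_scalar, h3]
      rw [Matrix.map_mul, Matrix.map_mul, map_comul_scalar, map_comul_scalar, map_comul_mat,
        ← Matrix.map_mul, ← Matrix.map_mul, algebraMap_mul_tmulMat, tmulMat_mul_algebraMap, e]
    intro i j
    have := congrFun (congrFun key i) j
    simpa [tmulMat] using this

theorem intertwines_restrict (u : FinDimRep G) {κ : Type} [Fintype κ] [DecidableEq κ]
    (S : Matrix u.ι κ ℂ) (hS : Sᴴ * S = 1) (hu : Intertwines u u (S * Sᴴ)) :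
    Intertwines (u.restrict S hS hu) u S := by
  have h2 : scalar G (S * Sᴴ) * u.mat = u.mat * scalar G (S * Sᴴ) := hu
  change scalar G S * (scalar G Sᴴ * u.mat * scalar G S) = u.mat * scalar G S
  rw [← Matrix.mul_assoc, ← Matrix.mul_assoc, ← scalar_mul, h2, Matrix.mul_assoc, ← scalar_mul,
    Matrix.mul_assoc, hS, Matrix.mul_one]

theorem isSubrep_restrict (u : FinDimRep G) {κ : Type} [Fintype κ] [DecidableEq κ]
    (S : Matrix u.ι κ ℂ) (hS : Sᴴ * S = 1) (hu : Intertwines u u (S * Sᴴ)) :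
    IsSubrep (u.restrict S hS hu) u :=
  ⟨S, intertwines_restrict u S hS hu, hS⟩

theorem IsSubrep.refl (u : FinDimRep G) : IsSubrep u u :=
  ⟨1, by simp [Intertwines], by simp⟩

theorem IsSubrep.trans {u v w : FinDimRep G} (h : IsSubrep u v) (h' : IsSubrep v w) :
    IsSubrep u w := by
  obtain ⟨T, hT, h1⟩ := h
  obtain ⟨T', hT', h1'⟩ := h'
  refine ⟨T' * T, hT'.comp hT, ?_⟩
  rw [Matrix.conjTranspose_mul, Matrix.mul_assoc, ← Matrix.mul_assoc T'ᴴ, h1', Matrix.one_mul, h1]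

theorem Equivalent.card_eq {u v : FinDimRep G} (h : Equivalent u v) :
    Fintype.card u.ι = Fintype.card v.ι := by
  obtain ⟨T, S, -, h1, h2⟩ := h
  exact (Matrix.square_of_invertible S T h1 h2)

open scoped Kronecker in
theorem IsSubrep.tensor_right {u v : FinDimRep G} (h : IsSubrep u v) (x : FinDimRep G) :
    IsSubrep (u.tensor x) (v.tensor x) := by
  obtain ⟨T, hT, h1⟩ := h
  refine ⟨T ⊗ₖ (1 : Matrix x.ι x.ι ℂ), ?_, ?_⟩
  · simp only [Intertwines, ← Matrix.ext_iff, Matrix.mul_apply, scalar, Matrix.map_apply] at hT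
    unfold Intertwines
    ext ⟨i, k⟩ ⟨j, l⟩
    change ∑ p : u.ι × x.ι, algebraMap ℂ G.alg (T i p.1 * (1 : Matrix x.ι x.ι ℂ) k p.2) *
        (u.mat p.1 j * x.mat p.2 l) = ∑ p : v.ι × x.ι, v.mat i p.1 * x.mat k p.2 *
          algebraMap ℂ G.alg (T p.1 j * (1 : Matrix x.ι x.ι ℂ) p.2 l)
    have := congrArg (· * x.mat k l) (hT i j)
    simpa [Fintype.sum_prod_type, Matrix.one_apply, apply_ite (algebraMap ℂ G.alg), Finset.sum_mul,
      mul_assoc, ← Algebra.commutes] using this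
  · change (T ⊗ₖ (1 : Matrix x.ι x.ι ℂ))ᴴ * (T ⊗ₖ (1 : Matrix x.ι x.ι ℂ)) = 1
    rw [Matrix.conjTranspose_kronecker, ← Matrix.mul_kronecker_mul, h1, Matrix.conjTranspose_one,
      Matrix.one_mul, Matrix.one_kronecker_one]

/-! ### Spectral projections, Schur's lemma and complete reducibility. -/

open scoped ComplexOrder

/-- The eigenvectors of a Hermitian matrix that belong to the indices satisfying `p`, as columns. -/
def eigenIsometry {n : Type} [Fintype n] [DecidableEq n] {M : Matrix n n ℂ} (hM : M.IsHermitian)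
    (p : n → Prop) : Matrix n {i // p i} ℂ :=
  (hM.eigenvectorUnitary : Matrix n n ℂ).submatrix id Subtype.val

section eigen

variable {n : Type} [Fintype n] [DecidableEq n] {M : Matrix n n ℂ} (hM : M.IsHermitian)

theorem eigenvectorUnitary_conjTranspose_mul :
    (hM.eigenvectorUnitary : Matrix n n ℂ)ᴴ * (hM.eigenvectorUnitary : Matrix n n ℂ) = 1 :=
  (Unitary.mem_iff.1 hM.eigenvectorUnitary.2).1

theorem eigenvectorUnitary_mul_conjTranspose :
    (hM.eigenvectorUnitary : Matrix n n ℂ) * (hM.eigenvectorUnitary : Matrix n n ℂ)ᴴ = 1 :=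
  (Unitary.mem_iff.1 hM.eigenvectorUnitary.2).2

theorem eq_mul_diagonal_mul :
    M = (hM.eigenvectorUnitary : Matrix n n ℂ) *
      Matrix.diagonal (fun i => (hM.eigenvalues i : ℂ)) *
        (hM.eigenvectorUnitary : Matrix n n ℂ)ᴴ := by
  conv_lhs => rw [hM.spectral_theorem, Unitary.conjStarAlgAut_apply]
  rfl

theorem eigenIsometry_conjTranspose_mul (p : n → Prop) [DecidablePred p] :
    (eigenIsometry hM p)ᴴ * eigenIsometry hM p = 1 := by
  ext i j
  have := congrFun (congrFun (eigenvectorUnitary_conjTranspose_mul hM) i) j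
  simpa [eigenIsometry, Matrix.mul_apply, Matrix.one_apply, Subtype.ext_iff] using this

theorem eigenIsometry_conjTranspose_mul_of_disjoint (p q : n → Prop) (h : ∀ i, p i → ¬ q i) :
    (eigenIsometry hM p)ᴴ * eigenIsometry hM q = 0 := by
  ext i j
  have := congrFun (congrFun (eigenvectorUnitary_conjTranspose_mul hM) i) j
  have hij : i.1 ≠ j.1 := fun e => h i i.2 (e ▸ j.2)
  simpa [eigenIsometry, Matrix.mul_apply, Matrix.one_apply, hij] using this

theorem eigenIsometry_mul_conjTranspose (p : n → Prop) [DecidablePred p] :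
    eigenIsometry hM p * (eigenIsometry hM p)ᴴ = (hM.eigenvectorUnitary : Matrix n n ℂ) *
      Matrix.diagonal (fun i => if p i then 1 else 0) *
        (hM.eigenvectorUnitary : Matrix n n ℂ)ᴴ := by
  ext i j
  rw [Matrix.mul_apply, Matrix.mul_apply]
  simp only [eigenIsometry, Matrix.conjTranspose_apply, Matrix.submatrix_apply,
    id_eq, Matrix.mul_diagonal, mul_ite, mul_one, mul_zero, ite_mul, zero_mul]
  rw [← Finset.sum_filter]
  exact (Finset.sum_subtype _ (by simp) fun k => (hM.eigenvectorUnitary : Matrix n n ℂ) i k *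
    star ((hM.eigenvectorUnitary : Matrix n n ℂ) j k)).symm

theorem eigenIsometry_mul_conjTranspose_add (p q : n → Prop) [DecidablePred p] [DecidablePred q]
    (h : ∀ i, q i ↔ ¬ p i) : eigenIsometry hM p * (eigenIsometry hM p)ᴴ +
      eigenIsometry hM q * (eigenIsometry hM q)ᴴ = 1 := by
  rw [eigenIsometry_mul_conjTranspose, eigenIsometry_mul_conjTranspose, ← Matrix.add_mul,
    ← Matrix.mul_add, Matrix.diagonal_add]
  have : (fun i => (if p i then (1 : ℂ) else 0) + if q i then 1 else 0) = fun _ => 1 := by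
    funext i
    by_cases hi : p i <;> simp [h, hi]
  rw [this, Matrix.diagonal_one, Matrix.mul_one, eigenvectorUnitary_mul_conjTranspose]

end eigen

/-- In an eigenbasis of `M`, commuting with `M` forces the coefficients of `u` between distinct
eigenvalues to vanish. By `hp` the projection is constant on each eigenspace, so it commutes with
the remaining blocks. -/
theorem intertwines_eigenIsometry {u : FinDimRep G} {M : Matrix u.ι u.ι ℂ} (hM : M.IsHermitian)
    (hu : Intertwines u u M) (p : u.ι → Prop) [DecidablePred p]
    (hp : ∀ i j, hM.eigenvalues i = hM.eigenvalues j → (p i ↔ p j)) :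
    Intertwines u u (eigenIsometry hM p * (eigenIsometry hM p)ᴴ) := by
  rw [eigenIsometry_mul_conjTranspose]
  set U : Matrix u.ι u.ι ℂ := (hM.eigenvectorUnitary : Matrix u.ι u.ι ℂ) with hU
  have h1 : scalar G Uᴴ * scalar G U = 1 := by
    rw [← scalar_mul, hU, eigenvectorUnitary_conjTranspose_mul, scalar_one]
  have h2 : scalar G U * scalar G Uᴴ = 1 := by
    rw [← scalar_mul, hU, eigenvectorUnitary_mul_conjTranspose, scalar_one]
  -- Passing to the eigenbasis treats `M` and the spectral projection alike: both become diagonal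
  -- matrices.
  have conj : ∀ d : u.ι → ℂ, Intertwines u u (U * Matrix.diagonal d * Uᴴ) ↔
      scalar G (Matrix.diagonal d) * (scalar G Uᴴ * u.mat * scalar G U) =
        (scalar G Uᴴ * u.mat * scalar G U) * scalar G (Matrix.diagonal d) := by
    intro d
    unfold Intertwines
    rw [scalar_mul, scalar_mul]
    generalize scalar G (Matrix.diagonal d) = D
    constructor
    · intro h
      have := congrArg (fun A => scalar G Uᴴ * A * scalar G U) h
      simp only [← Matrix.mul_assoc, h1, Matrix.one_mul] at this
      simpa only [Matrix.mul_assoc, h1, Matrix.mul_one] using this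
    · intro h
      have := congrArg (fun A => scalar G U * A * scalar G Uᴴ) h
      simp only [← Matrix.mul_assoc, h2, Matrix.one_mul] at this
      simpa only [Matrix.mul_assoc, h2, Matrix.mul_one] using this
  have h3 := hu
  rw [eq_mul_diagonal_mul hM] at h3
  rw [conj] at h3 ⊢
  generalize scalar G Uᴴ * u.mat * scalar G U = A at h3 ⊢
  have entry : ∀ (d : u.ι → ℂ), scalar G (Matrix.diagonal d) =
      Matrix.diagonal fun i => algebraMap ℂ G.alg (d i) := fun d => by
    simp [scalar, Matrix.diagonal_map]
  rw [entry] at h3 ⊢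
  ext i j
  have h4 := congrFun (congrFun h3 i) j
  simp only [Matrix.diagonal_mul, Matrix.mul_diagonal, ← Algebra.commutes,
    ← Algebra.smul_def] at h4 ⊢
  by_cases hij : hM.eigenvalues i = hM.eigenvalues j
  · simp [hp i j hij]
  · have : A i j = 0 := by
      rw [← sub_eq_zero, ← sub_smul, smul_eq_zero, sub_eq_zero] at h4
      exact h4.resolve_left fun h => hij (by exact_mod_cast h)
    simp [this]

/-- The block row `[T₁ T₂]` is a unitary intertwiner from the direct sum to `u`. -/
theorem equivalent_directSum {u w₁ w₂ : FinDimRep G} {T₁ : Matrix u.ι w₁.ι ℂ}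
    {T₂ : Matrix u.ι w₂.ι ℂ} (h₁ : Intertwines w₁ u T₁) (h₂ : Intertwines w₂ u T₂)
    (h₁₁ : T₁ᴴ * T₁ = 1) (h₂₂ : T₂ᴴ * T₂ = 1) (h₁₂ : T₁ᴴ * T₂ = 0) (h₂₁ : T₂ᴴ * T₁ = 0)
    (h : T₁ * T₁ᴴ + T₂ * T₂ᴴ = 1) : Equivalent u (w₁.directSum w₂) := by
  have e : scalar G (Matrix.fromCols T₁ T₂) =
      Matrix.fromCols (scalar G T₁) (scalar G T₂) := by
    ext a (b | b) <;> rfl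
  have e1 : scalar G (Matrix.fromCols T₁ T₂) * Matrix.fromBlocks w₁.mat 0 0 w₂.mat =
      u.mat * scalar G (Matrix.fromCols T₁ T₂) := by
    rw [e, Matrix.fromCols_mul_fromBlocks, Matrix.mul_fromCols]
    simp only [Matrix.mul_zero, add_zero, zero_add]
    rw [h₁, h₂]
  have e2 : Matrix.fromRows T₁ᴴ T₂ᴴ * Matrix.fromCols T₁ T₂ = 1 := by
    rw [Matrix.fromRows_mul_fromCols, h₁₁, h₂₂, h₁₂, h₂₁, Matrix.fromBlocks_one]
  have e3 : Matrix.fromCols T₁ T₂ * Matrix.fromRows T₁ᴴ T₂ᴴ = 1 := by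
    rw [Matrix.fromCols_mul_fromRows, h]
  exact Equivalent.symm ⟨Matrix.fromCols T₁ T₂, Matrix.fromRows T₁ᴴ T₂ᴴ, e1, e2, e3⟩

/-- A representation with a nonscalar Hermitian endomorphism is decomposable. -/
theorem exists_equivalent_directSum {u : FinDimRep G} {M : Matrix u.ι u.ι ℂ} (hM : M.IsHermitian)
    (hu : Intertwines u u M) (hc : ∀ c : ℂ, M ≠ c • 1) :
    ∃ w₁ w₂ : FinDimRep G, IsSubrep w₁ u ∧ IsSubrep w₂ u ∧ Equivalent u (w₁.directSum w₂) ∧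
      0 < Fintype.card w₁.ι ∧ 0 < Fintype.card w₂.ι := by
  classical
  have hne : ∃ i j, hM.eigenvalues i ≠ hM.eigenvalues j := by
    by_contra! h
    rcases isEmpty_or_nonempty u.ι with h0 | ⟨⟨i⟩⟩
    · exact hc 0 (by ext i; exact h0.elim i)
    · refine hc (hM.eigenvalues i) ?_
      conv_lhs => rw [eq_mul_diagonal_mul hM]
      rw [show (fun j => (hM.eigenvalues j : ℂ)) =
        fun _ => (hM.eigenvalues i : ℂ) from funext fun j => by rw [h j i],
        ← Matrix.smul_one_eq_diagonal, Matrix.mul_smul, Matrix.mul_one, Matrix.smul_mul,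
        eigenvectorUnitary_mul_conjTranspose]
  obtain ⟨i, j, hij⟩ := hne
  -- Split off the eigenspace of the `i`-th eigenvalue; the index `j` shows that the complement is
  -- nonzero.
  let p : u.ι → Prop := fun k => hM.eigenvalues k = hM.eigenvalues i
  let q : u.ι → Prop := fun k => ¬ p k
  have hp := intertwines_eigenIsometry hM hu p fun a b h => by simp [p, h]
  have hq := intertwines_eigenIsometry hM hu q fun a b h => by simp [q, p, h]
  have hpp := eigenIsometry_conjTranspose_mul hM p
  have hqq := eigenIsometry_conjTranspose_mul hM q
  have hpq := eigenIsometry_conjTranspose_mul_of_disjoint hM p q fun i h h' => h' h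
  have hqp := eigenIsometry_conjTranspose_mul_of_disjoint hM q p fun i h h' => h h'
  have hadd := eigenIsometry_mul_conjTranspose_add hM p q fun i => Iff.rfl
  refine ⟨u.restrict _ hpp hp, u.restrict _ hqq hq, isSubrep_restrict _ _ _ _,
    isSubrep_restrict _ _ _ _, ?_, ?_, ?_⟩
  · exact equivalent_directSum (intertwines_restrict u _ hpp hp) (intertwines_restrict u _ hqq hq)
      hpp hqq hpq hqp hadd
  · exact Fintype.card_pos_iff.2 ⟨(⟨i, rfl⟩ : {k // p k})⟩
  · exact Fintype.card_pos_iff.2 ⟨(⟨j, fun h => hij h.symm⟩ : {k // q k})⟩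

theorem card_directSum (u v : FinDimRep G) :
    Fintype.card (u.directSum v).ι = Fintype.card u.ι + Fintype.card v.ι :=
  Fintype.card_sum

/-- Schur's lemma for Hermitian endomorphisms: a nonscalar one would split `u` into two nonzero
pieces, each of dimension strictly below that of `u`. -/
theorem IsIrreducible.eq_smul_one {u : FinDimRep G} (h : u.IsIrreducible) {M : Matrix u.ι u.ι ℂ}
    (hM : M.IsHermitian) (hu : Intertwines u u M) : ∃ c : ℂ, M = c • 1 := by
  by_contra! hc
  obtain ⟨w₁, w₂, h1, -, he, c1, c2⟩ := exists_equivalent_directSum hM hu hc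
  have := he.card_eq
  rw [card_directSum] at this
  have := h.2 w₁ h1
  omega

/-- `T* T` and `T T*` are Hermitian endomorphisms, hence scalars `c` and `d`. They are nonzero
because `T` is, and equal because `T T* T` is both `c T` and `d T`; so `c⁻¹ T*` inverts `T`. -/
theorem Intertwines.equivalent_of_isIrreducible {u v : FinDimRep G} {T : Matrix v.ι u.ι ℂ}
    (h : Intertwines u v T) (hu : u.IsIrreducible) (hv : v.IsIrreducible) (hT : T ≠ 0) :
    Equivalent u v := by
  obtain ⟨c, hc⟩ := hu.eq_smul_one (Matrix.isHermitian_conjTranspose_mul_self T)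
    (h.conjTranspose.comp h)
  obtain ⟨d, hd⟩ := hv.eq_smul_one (Matrix.isHermitian_mul_conjTranspose_self T)
    (h.comp h.conjTranspose)
  have hc0 : c ≠ 0 := by
    rintro rfl
    rw [zero_smul] at hc
    exact hT (Matrix.conjTranspose_mul_self_eq_zero.1 hc)
  have hd0 : d ≠ 0 := by
    rintro rfl
    rw [zero_smul] at hd
    exact hT (Matrix.self_mul_conjTranspose_eq_zero.1 hd)
  have hcd : c = d := by
    have h1 : T * Tᴴ * T = d • T := by rw [hd, Matrix.smul_mul, Matrix.one_mul]
    rw [Matrix.mul_assoc, hc, Matrix.mul_smul, Matrix.mul_one] at h1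
    exact smul_left_injective ℂ hT h1
  refine ⟨T, c⁻¹ • Tᴴ, h, ?_, ?_⟩
  · rw [Matrix.smul_mul, hc, smul_smul, inv_mul_cancel₀ hc0, one_smul]
  · rw [Matrix.mul_smul, hd, smul_smul, hcd, inv_mul_cancel₀ hd0, one_smul]

/-- The range projection `T T*` of a proper nonzero subrepresentation is a nonscalar endomorphism:
if it were `c`, then `T = c T` would give `c = 1`, so `T` would be invertible and the dimensions
equal. -/
theorem exists_equivalent_directSum_of_not_isIrreducible {u : FinDimRep G}
    (h : ¬ u.IsIrreducible) (hu : 0 < Fintype.card u.ι) :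
    ∃ w₁ w₂ : FinDimRep G, IsSubrep w₁ u ∧ IsSubrep w₂ u ∧ Equivalent u (w₁.directSum w₂) ∧
      0 < Fintype.card w₁.ι ∧ 0 < Fintype.card w₂.ι := by
  simp only [IsIrreducible, not_and, not_forall, not_or] at h
  obtain ⟨w, ⟨T, hT, h1⟩, hw0, hw1⟩ := h hu
  refine exists_equivalent_directSum (Matrix.isHermitian_mul_conjTranspose_self T)
    (hT.comp hT.conjTranspose) fun c hc => ?_
  have hT0 : T ≠ 0 := by
    rintro rfl
    obtain ⟨i⟩ := Fintype.card_pos_iff.1 (Nat.pos_of_ne_zero hw0)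
    simpa using congrFun (congrFun h1 i) i
  have h2 : T * Tᴴ * T = c • T := by rw [hc, Matrix.smul_mul, Matrix.one_mul]
  rw [Matrix.mul_assoc, h1, Matrix.mul_one] at h2
  have hc1 : c = 1 := smul_left_injective ℂ hT0 (by simpa using h2.symm)
  rw [hc1, one_smul] at hc
  exact hw1 (Matrix.square_of_invertible Tᴴ T h1 hc)

/-- Complete reducibility. -/
theorem exists_eq_sum_isIrreducible (u : FinDimRep G) : ∃ L : List (FinDimRep G),
    (∀ w ∈ L, w.IsIrreducible ∧ IsSubrep w u) ∧ RepClass.mk u = (L.map RepClass.mk).sum := by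
  induction hn : Fintype.card u.ι using Nat.strong_induction_on generalizing u with
  | _ n ih =>
    by_cases hu : u.IsIrreducible
    · exact ⟨[u], by simpa using ⟨hu, IsSubrep.refl u⟩, by simp⟩
    rcases Nat.eq_zero_or_pos (Fintype.card u.ι) with h0 | h0
    · have : IsEmpty u.ι := Fintype.card_eq_zero_iff.1 h0
      exact ⟨[], by simp, RepClass.mk_eq_of_equiv (v := zero G) (Equiv.equivOfIsEmpty u.ι Empty)
        fun i => isEmptyElim i⟩
    · obtain ⟨w₁, w₂, h1, h2, he, c1, c2⟩ :=
        exists_equivalent_directSum_of_not_isIrreducible hu h0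
      have hc := he.card_eq
      rw [card_directSum] at hc
      obtain ⟨L₁, hL₁, e₁⟩ := ih _ (by omega) w₁ rfl
      obtain ⟨L₂, hL₂, e₂⟩ := ih _ (by omega) w₂ rfl
      refine ⟨L₁ ++ L₂, fun w hw => ?_, ?_⟩
      · rcases List.mem_append.1 hw with hw | hw
        · exact ⟨(hL₁ w hw).1, (hL₁ w hw).2.trans h1⟩
        · exact ⟨(hL₂ w hw).1, (hL₂ w hw).2.trans h2⟩
      · rw [List.map_append, List.sum_append, ← e₁, ← e₂]
        exact Quotient.sound he

theorem Intertwines.fst_directSum {u v w : FinDimRep G} {T : Matrix (v.directSum w).ι u.ι ℂ}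
    (h : Intertwines u (v.directSum w) T) :
    Intertwines u v (Matrix.of fun i j => T (Sum.inl i) j) := by
  ext i j
  have : ∑ k, algebraMap ℂ G.alg (T (Sum.inl i) k) * u.mat k j = ∑ p : v.ι ⊕ w.ι,
      Matrix.fromBlocks v.mat 0 0 w.mat (Sum.inl i) p * algebraMap ℂ G.alg (T p j) :=
    congrFun (congrFun h (Sum.inl i)) j
  simpa [scalar, Matrix.mul_apply] using this

theorem Intertwines.snd_directSum {u v w : FinDimRep G} {T : Matrix (v.directSum w).ι u.ι ℂ}
    (h : Intertwines u (v.directSum w) T) :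
    Intertwines u w (Matrix.of fun i j => T (Sum.inr i) j) := by
  ext i j
  have : ∑ k, algebraMap ℂ G.alg (T (Sum.inr i) k) * u.mat k j = ∑ p : v.ι ⊕ w.ι,
      Matrix.fromBlocks v.mat 0 0 w.mat (Sum.inr i) p * algebraMap ℂ G.alg (T p j) :=
    congrFun (congrFun h (Sum.inr i)) j
  simpa [scalar, Matrix.mul_apply] using this

/-- An irreducible representation that maps nontrivially to a sum of irreducible representations is
equivalent to one of them. -/
theorem Intertwines.mk_mem_of_eq_sum {u : FinDimRep G} (hu : u.IsIrreducible)
    (L : List (FinDimRep G)) (hL : ∀ w ∈ L, w.IsIrreducible) {v : FinDimRep G}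
    (hv : RepClass.mk v = (L.map RepClass.mk).sum) {T : Matrix v.ι u.ι ℂ}
    (h : Intertwines u v T) (hT : T ≠ 0) : ∃ w ∈ L, RepClass.mk u = RepClass.mk w := by
  induction L generalizing v with
  | nil =>
    have : Equivalent v (zero G) := Quotient.exact hv
    have : IsEmpty v.ι := Fintype.card_eq_zero_iff.1 this.card_eq
    exact absurd (by ext i; exact isEmptyElim i) hT
  | cons w L ih =>
    obtain ⟨v', hv'⟩ : ∃ v', RepClass.mk v' = (L.map RepClass.mk).sum :=
      Quotient.exists_rep _
    rw [List.map_cons, List.sum_cons, ← hv'] at hv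
    obtain ⟨A, B, hA, hBA, hAB⟩ : Equivalent v (w.directSum v') := Quotient.exact hv
    have h' := hA.comp h
    have hAT : A * T ≠ 0 := fun h0 => hT <| by
      rw [← Matrix.one_mul T, ← hBA, Matrix.mul_assoc, h0, Matrix.mul_zero]
    -- Either the component into `w` is nonzero and Schur's lemma applies, or the component into the
    -- remaining sum is nonzero and induction does.
    by_cases h1 : (Matrix.of fun i j => (A * T) (Sum.inl i) j : Matrix w.ι u.ι ℂ) = 0
    · obtain ⟨x, hx, e⟩ := ih (fun x hx => hL x (List.mem_cons_of_mem _ hx)) hv'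
        h'.snd_directSum fun h2 => hAT <| by
          ext (i | i) j
          · exact congrFun (congrFun h1 i) j
          · exact congrFun (congrFun h2 i) j
      exact ⟨x, List.mem_cons_of_mem _ hx, e⟩
    · exact ⟨w, List.mem_cons_self, Quotient.sound
        (h'.fst_directSum.equivalent_of_isIrreducible hu (hL w List.mem_cons_self) h1)⟩

theorem IsSubrep.card_le {u v : FinDimRep G} (h : IsSubrep u v) :
    Fintype.card u.ι ≤ Fintype.card v.ι := by
  obtain ⟨T, -, h⟩ := h
  calc Fintype.card u.ι = (Tᴴ * T).rank := by rw [h, Matrix.rank_one]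
    _ ≤ Tᴴ.rank := Matrix.rank_mul_le_left _ _
    _ ≤ Fintype.card v.ι := Matrix.rank_le_card_width _

theorem isIrreducible_trivial (G : CompactQuantumGroup.{u}) : (trivial G).IsIrreducible := by
  refine ⟨Nat.one_pos, fun w h => ?_⟩
  have h1 : Fintype.card (trivial G).ι = 1 := rfl
  have := h.card_le
  omega

end FinDimRep

/-! ### Representations over the coordinate algebra and their pullbacks. -/

namespace FinDimRep

variable {G : CompactQuantumGroup.{u}} {K : CompactQuantumGroup.{v}}

/-- The matrix of coefficients, over the coordinate algebra. -/
def coordMat (u : FinDimRep G) : Matrix u.ι u.ι G.coord :=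
  Matrix.of fun i j => ⟨u.mat i j, mat_mem_coord u i j⟩

theorem conjTranspose_coordMat_mul (u : FinDimRep G) : u.coordMatᴴ * u.coordMat = 1 := by
  ext i j
  have := congrFun (congrFun u.conjTranspose_mat_mul i) j
  rw [Matrix.mul_apply] at this ⊢
  rw [Matrix.one_apply] at this ⊢
  simp only [Matrix.conjTranspose_apply, coordMat, Matrix.of_apply]
  split_ifs at this ⊢ <;> simpa using this

theorem coordMat_mul_conjTranspose (u : FinDimRep G) : u.coordMat * u.coordMatᴴ = 1 := by
  ext i j
  have := congrFun (congrFun u.mat_mul_conjTranspose i) j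
  rw [Matrix.mul_apply] at this ⊢
  rw [Matrix.one_apply] at this ⊢
  simp only [Matrix.conjTranspose_apply, coordMat, Matrix.of_apply]
  split_ifs at this ⊢ <;> simpa using this

theorem coordComul_coordMat (u : FinDimRep G) (i j : u.ι) :
    G.coordComul (u.coordMat i j) = ∑ k, u.coordMat i k ⊗ₜ u.coordMat k j :=
  coordComul_mat u i j

/-- A representation, given by a unitary corepresentation matrix over the coordinate algebra. -/
def ofCoord {κ : Type} [Fintype κ] [DecidableEq κ] (m : Matrix κ κ G.coord) (h₁ : mᴴ * m = 1)
    (h₂ : m * mᴴ = 1) (h : ∀ i j, G.coordComul (m i j) = ∑ k, m i k ⊗ₜ m k j) : FinDimRep G where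
  ι := κ
  mat := m.map G.coord.subtype
  mem_unitary := by
    have e : (m.map G.coord.subtype)ᴴ = mᴴ.map G.coord.subtype := rfl
    have e1 : (1 : Matrix κ κ G.coord).map G.coord.subtype = 1 :=
      Matrix.map_one _ (map_zero _) (map_one _)
    rw [Unitary.mem_iff, Matrix.star_eq_conjTranspose, e, ← Matrix.map_mul, ← Matrix.map_mul,
      h₁, h₂]
    exact ⟨e1, e1⟩
  comul_mat i j := by
    refine Subtype.ext ((G.coordTensor_coordComul (m i j)).symm.trans ?_)
    rw [h, map_sum]
    exact (map_sum (minTensor G.rep G.rep).subtype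
      (fun k => G.algTensor ((m i k : G.alg) ⊗ₜ (m k j : G.alg))) Finset.univ).symm

/-- An equality of representations, not merely an equivalence; it makes iterated pullbacks agree
strictly. -/
theorem ofCoord_coordMat (u : FinDimRep G) {m : Matrix u.ι u.ι G.coord} {h₁ h₂ h}
    (hm : m = u.coordMat) : ofCoord m h₁ h₂ h = u := by
  subst hm; rfl

/-- The representation of `G` obtained from a representation of `K` and a morphism `G → K`. -/
def pull (f : Hom G K) (u : FinDimRep K) : FinDimRep G :=
  ofCoord (u.coordMat.map f.pullback)
    (by
      have e : (u.coordMat.map f.pullback)ᴴ = u.coordMatᴴ.map f.pullback := by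
        ext i j : 1
        exact (map_star f.pullback _).symm
      rw [e, ← Matrix.map_mul, conjTranspose_coordMat_mul]
      exact Matrix.map_one _ (map_zero _) (map_one _))
    (by
      have e : (u.coordMat.map f.pullback)ᴴ = u.coordMatᴴ.map f.pullback := by
        ext i j : 1
        exact (map_star f.pullback _).symm
      rw [e, ← Matrix.map_mul, coordMat_mul_conjTranspose]
      exact Matrix.map_one _ (map_zero _) (map_one _))
    (by
      intro i j
      rw [Matrix.map_apply, ← f.map_comul, coordComul_coordMat, map_sum]
      rfl)

/-- Turns an intertwining relation into finitely many equations in `Q_G`, to which a pullback can be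
applied. Since `X` is arbitrary, it serves for `u` and for its matrix of adjoints. -/
theorem scalar_mul_eq_mul_scalar_iff {m n : Type} [Fintype m] [Fintype n] (T : Matrix m n ℂ)
    (X : Matrix n n G.coord) (Y : Matrix m m G.coord) :
    scalar G T * X.map G.coord.subtype = Y.map G.coord.subtype * scalar G T ↔
      ∀ a b, ∑ k, T a k • X k b = ∑ k, T k b • Y a k := by
  rw [← Matrix.ext_iff]
  refine forall₂_congr fun a b => ?_
  rw [← Subtype.coe_inj]
  simp [scalar, Matrix.mul_apply, ← Algebra.commutes, ← Algebra.smul_def]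

theorem intertwines_iff {u v : FinDimRep G} (T : Matrix v.ι u.ι ℂ) : Intertwines u v T ↔
    ∀ a b, ∑ k, T a k • u.coordMat k b = ∑ k, T k b • v.coordMat a k :=
  scalar_mul_eq_mul_scalar_iff T u.coordMat v.coordMat

theorem conj_intertwines_iff {u v : FinDimRep G} (T : Matrix v.ι u.ι ℂ) :
    scalar G T * u.mat.map star = v.mat * scalar G T ↔
      ∀ a b, ∑ k, T a k • star (u.coordMat k b) = ∑ k, T k b • v.coordMat a k :=
  scalar_mul_eq_mul_scalar_iff T (u.coordMat.map star) v.coordMat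

theorem intertwines_pull_iff (f : Hom G K) {u v : FinDimRep K} (T : Matrix v.ι u.ι ℂ) :
    Intertwines (pull f u) (pull f v) T ↔ ∀ a b, f.pullback (∑ k, T a k • u.coordMat k b) =
      f.pullback (∑ k, T k b • v.coordMat a k) := by
  refine (intertwines_iff (u := pull f u) (v := pull f v) T).trans (forall₂_congr fun a b => ?_)
  simp only [map_sum, map_smul]
  rfl

theorem conj_intertwines_pull_iff (f : Hom G K) {u v : FinDimRep K}
    (T : Matrix (pull f v).ι (pull f u).ι ℂ) :
    scalar G T * (pull f u).mat.map star = (pull f v).mat * scalar G T ↔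
      ∀ a b, f.pullback (∑ k, T a k • star (u.coordMat k b)) =
        f.pullback (∑ k, T k b • v.coordMat a k) := by
  refine (conj_intertwines_iff (u := pull f u) (v := pull f v) T).trans
    (forall₂_congr fun a b => ?_)
  simp only [map_sum, map_smul, map_star]
  rfl

theorem Intertwines.pull (f : Hom G K) {u v : FinDimRep K} {T : Matrix v.ι u.ι ℂ}
    (h : Intertwines u v T) : Intertwines (pull f u) (pull f v) T :=
  (intertwines_pull_iff f T).2 fun a b => congrArg _ ((intertwines_iff T).1 h a b)

theorem Equivalent.pull (f : Hom G K) {u v : FinDimRep K} (h : Equivalent u v) :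
    Equivalent (pull f u) (pull f v) := by
  obtain ⟨T, S, hT, h1, h2⟩ := h
  exact ⟨T, S, hT.pull f, h1, h2⟩

theorem IsSubrep.pull (f : Hom G K) {u v : FinDimRep K} (h : IsSubrep u v) :
    IsSubrep (pull f u) (pull f v) := by
  obtain ⟨T, hT, h1⟩ := h
  exact ⟨T, hT.pull f, h1⟩

/-- Pullback preserves subrepresentations and dimensions, so a proper nonzero one of `u` would
survive. -/
theorem isIrreducible_of_pull (f : Hom G K) {u : FinDimRep K} (h : (pull f u).IsIrreducible) :
    u.IsIrreducible :=
  ⟨h.1, fun _ hw => h.2 _ (hw.pull f)⟩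

end FinDimRep

/-! ### Functoriality of representation classes and the Grothendieck ring. -/

namespace RepClass

variable {G : CompactQuantumGroup.{u}} {K : CompactQuantumGroup.{v}}

/-- The homomorphism of semirings of representations induced by a morphism `G → K`. -/
def map (f : Hom G K) : RepClass K →+* RepClass G where
  toFun := Quotient.map (FinDimRep.pull f) fun _ _ h => h.pull f
  map_zero' := mk_eq_of_equiv (Equiv.refl Empty) (by rintro ⟨⟩)
  map_one' := mk_eq_of_equiv (Equiv.refl Unit) fun i j => by
    have e : (FinDimRep.trivial K).coordMat i j = 1 :=
      Subtype.ext (Matrix.one_apply_eq (α := K.alg) ())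
    exact (congrArg (fun x => (f.pullback x : G.alg)) e).trans
      ((congrArg Subtype.val (map_one f.pullback)).trans (Matrix.one_apply_eq ()).symm)
  map_add' := by
    rintro ⟨u⟩ ⟨v⟩
    refine mk_eq_of_equiv (Equiv.refl (u.ι ⊕ v.ι)) ?_
    rintro (i | i) (j | j)
    · rfl
    · exact congrArg Subtype.val (map_zero f.pullback)
    · exact congrArg Subtype.val (map_zero f.pullback)
    · rfl
  map_mul' := by
    rintro ⟨u⟩ ⟨v⟩
    refine mk_eq_of_equiv (Equiv.refl (u.ι × v.ι)) ?_
    rintro ⟨i, k⟩ ⟨j, l⟩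
    exact congrArg Subtype.val (map_mul f.pullback (u.coordMat i j) (v.coordMat k l))

theorem map_mk (f : Hom G K) (u : FinDimRep K) : map f (mk u) = mk (u.pull f) := rfl

/-- The dimension of a representation. -/
def card : RepClass G → ℕ :=
  Quotient.lift (fun u => Fintype.card u.ι) fun _ _ h => FinDimRep.Equivalent.card_eq h

theorem card_add (a b : RepClass G) : card (a + b) = card a + card b := by
  obtain ⟨u⟩ := a
  obtain ⟨v⟩ := b
  exact FinDimRep.card_directSum u v

end RepClass

instance (G : CompactQuantumGroup.{u}) : Nontrivial (RepRing G) := by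
  refine ⟨⟨RepRing.of 1, RepRing.of 0, fun h => ?_⟩⟩
  -- Dimension is additive, so it separates `c + 1` from `c + 0`.
  obtain ⟨c, hc⟩ := RepRing.of_eq_of_iff.1 h
  have h1 := congrArg RepClass.card hc
  have h2 : RepClass.card (1 : RepClass G) = 1 := rfl
  have h3 : RepClass.card (0 : RepClass G) = 0 := rfl
  rw [RepClass.card_add, RepClass.card_add] at h1
  omega

/-- Collecting signs makes the vanishing of a product an equality between images of actual
representations. -/
theorem RepRing.sub_mul_sub {G : CompactQuantumGroup.{u}} (a b c d : RepClass G) :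
    (RepRing.of a - RepRing.of b) * (RepRing.of c - RepRing.of d) =
      RepRing.of (a * c + b * d) - RepRing.of (a * d + b * c) := by
  simp only [map_add, RepRing.of_mul]
  noncomm_ring

theorem RepRing.of_map_eq_of_map {G : CompactQuantumGroup.{u}} {K : CompactQuantumGroup.{v}}
    (f : Hom G K) {a b : RepClass K} (h : RepRing.of a = RepRing.of b) :
    RepRing.of (RepClass.map f a) = RepRing.of (RepClass.map f b) := by
  obtain ⟨c, hc⟩ := RepRing.of_eq_of_iff.1 h
  exact RepRing.of_eq_of_iff.2 ⟨RepClass.map f c, by rw [← map_add, hc, map_add]⟩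

theorem FinDimRep.IsConjugate.pull {G : CompactQuantumGroup.{u}} {K : CompactQuantumGroup.{v}}
    (f : Hom G K) {u v : FinDimRep K} (h : u.IsConjugate v) :
    (u.pull f).IsConjugate (v.pull f) := by
  obtain ⟨T, T', h, h₁, h₂⟩ := h
  exact ⟨T, T', (conj_intertwines_pull_iff f T).2 fun a b =>
    congrArg _ ((conj_intertwines_iff T).1 h a b), h₁, h₂⟩

theorem InverseSystem.pull_pull {I : Type w} [Preorder I] (S : InverseSystem.{u} I)
    {i j k : I} (hij : i ≤ j) (hjk : j ≤ k) (u : FinDimRep (S.obj i)) :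
    (u.pull (S.map hij)).pull (S.map hjk) = u.pull (S.map (hij.trans hjk)) := by
  refine FinDimRep.ofCoord_coordMat (u := u.pull (S.map (hij.trans hjk))) ?_
  ext a b : 1
  exact S.map_comp hij hjk _

theorem InverseSystem.repClass_map_map {I : Type w} [Preorder I] (S : InverseSystem.{u} I)
    {i j k : I} (hij : i ≤ j) (hjk : j ≤ k) (a : RepClass (S.obj i)) :
    RepClass.map (S.map hjk) (RepClass.map (S.map hij) a) =
      RepClass.map (S.map (hij.trans hjk)) a := by
  obtain ⟨u⟩ := a
  exact congrArg RepClass.mk (S.pull_pull hij hjk u)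

/-! ### Descent of finite data from the limit to a stage. -/

namespace IsInverseLimit

variable {I : Type w} [Preorder I] {S : InverseSystem.{u} I}
  {G : CompactQuantumGroup.{v}} {proj : ∀ i, Hom G (S.obj i)}

theorem pull_pull (hG : IsInverseLimit S G proj) {i j : I} (hij : i ≤ j)
    (u : FinDimRep (S.obj i)) :
    (u.pull (S.map hij)).pull (proj j) = u.pull (proj i) := by
  refine FinDimRep.ofCoord_coordMat (u := u.pull (proj i)) ?_
  ext a b : 1
  exact hG.compatible hij _

theorem map_map (hG : IsInverseLimit S G proj) {i j : I} (hij : i ≤ j)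
    (a : RepClass (S.obj i)) :
    RepClass.map (proj j) (RepClass.map (S.map hij) a) = RepClass.map (proj i) a := by
  obtain ⟨u⟩ := a
  exact congrArg RepClass.mk (hG.pull_pull hij u)

variable [IsDirectedOrder I]

theorem exists_pullback_eq (hG : IsInverseLimit S G proj) {i : I} {κ : Type*} [Finite κ]
    {x y : κ → (S.obj i).coord} (h : ∀ k, (proj i).pullback (x k) = (proj i).pullback (y k)) :
    ∃ (j : I) (hij : i ≤ j), ∀ k, (S.map hij).pullback (x k) = (S.map hij).pullback (y k) := by
  refine exists_ge_forall_of_finite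
    (P := fun k j hij => (S.map hij).pullback (x k) = (S.map hij).pullback (y k)) ?_ fun k => ?_
  · intro k j l hij hjl e
    rw [← S.map_comp hij hjl, e, S.map_comp]
  · obtain ⟨j, hij, e⟩ := hG.eventually_zero i (x k - y k) (by rw [map_sub, h, sub_self])
    exact ⟨j, hij, by rwa [map_sub, sub_eq_zero] at e⟩

/-- The part of the kernel inside `M` is finite-dimensional, so it suffices to kill a finite
spanning set. -/
theorem exists_forall_pullback_eq_zero (hG : IsInverseLimit S G proj) {i : I}
    (M : Submodule ℂ (S.obj i).coord) [Module.Finite ℂ M] :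
    ∃ (j : I) (hij : i ≤ j), ∀ x ∈ M, (proj i).pullback x = 0 → (S.map hij).pullback x = 0 := by
  let N : Submodule ℂ (S.obj i).coord := LinearMap.ker (proj i).pullback.toLinearMap ⊓ M
  have : Module.Finite ℂ N := Submodule.finiteDimensional_inf_right _ _
  obtain ⟨s, hs⟩ := Module.Finite.iff_fg.1 this
  obtain ⟨j, hij, h⟩ := hG.exists_pullback_eq (i := i) (κ := s) (x := fun k => k.1)
    (y := fun _ => 0) fun k => by
      have : k.1 ∈ N := hs ▸ Submodule.subset_span k.2
      rw [map_zero]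
      exact this.1
  refine ⟨j, hij, fun x hx h0 => ?_⟩
  have hN : N ≤ LinearMap.ker (S.map hij).pullback.toLinearMap := by
    rw [← hs, Submodule.span_le]
    intro k hk
    exact (h ⟨k, hk⟩).trans (map_zero _)
  exact hN ⟨h0, hx⟩

/-- The limit hypothesis concerns elements, not tensors. But `t` comes from `M ⊗ N` with `M` and `N`
finite-dimensional, and at a late stage every element of `M ⊔ N` that dies in the limit has died. -/
theorem exists_tensorMap_eq_zero (hG : IsInverseLimit S G proj) {i : I}
    (t : (S.obj i).coord ⊗[ℂ] (S.obj i).coord)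
    (ht : TensorProduct.map (proj i).pullback.toLinearMap (proj i).pullback.toLinearMap t = 0) :
    ∃ (j : I) (hij : i ≤ j), TensorProduct.map (S.map hij).pullback.toLinearMap
      (S.map hij).pullback.toLinearMap t = 0 := by
  obtain ⟨M, N, hM, hN, hs⟩ := TensorProduct.exists_finite_submodule_of_setFinite {t}
    (Set.finite_singleton t)
  obtain ⟨j, hij, h⟩ := hG.exists_forall_pullback_eq_zero (M ⊔ N)
  exact ⟨j, hij, TensorProduct.map_map_eq_zero_of_mem_range_mapIncl _ _
    (fun x hx => h x (Submodule.mem_sup_left hx)) (fun x hx => h x (Submodule.mem_sup_right hx))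
    (hs rfl) ht⟩

/-- Two finite families of tensors over `Q_{G_i}` that agree over `Q_G` agree at a later stage. -/
theorem exists_tensorMap_eq (hG : IsInverseLimit S G proj) {i : I} {κ : Type*} [Finite κ]
    {x y : κ → (S.obj i).coord ⊗[ℂ] (S.obj i).coord}
    (h : ∀ k, TensorProduct.map (proj i).pullback.toLinearMap (proj i).pullback.toLinearMap (x k) =
      TensorProduct.map (proj i).pullback.toLinearMap (proj i).pullback.toLinearMap (y k)) :
    ∃ (j : I) (hij : i ≤ j), ∀ k, TensorProduct.map (S.map hij).pullback.toLinearMap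
      (S.map hij).pullback.toLinearMap (x k) = TensorProduct.map (S.map hij).pullback.toLinearMap
      (S.map hij).pullback.toLinearMap (y k) := by
  refine exists_ge_forall_of_finite
    (P := fun k j hij => TensorProduct.map (S.map hij).pullback.toLinearMap
      (S.map hij).pullback.toLinearMap (x k) = TensorProduct.map (S.map hij).pullback.toLinearMap
      (S.map hij).pullback.toLinearMap (y k)) ?_ fun k => ?_
  · intro k j l hij hjl e
    have hc : (S.map (hij.trans hjl)).pullback.toLinearMap =
        (S.map hjl).pullback.toLinearMap ∘ₗ (S.map hij).pullback.toLinearMap :=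
      LinearMap.ext fun z => (S.map_comp hij hjl z).symm
    rw [hc, TensorProduct.map_comp, LinearMap.comp_apply, LinearMap.comp_apply, e]
  · obtain ⟨j, hij, e⟩ := hG.exists_tensorMap_eq_zero (x k - y k) (by rw [map_sub, h, sub_self])
    exact ⟨j, hij, by rwa [map_sub, sub_eq_zero] at e⟩

theorem exists_intertwines_pull (hG : IsInverseLimit S G proj) {i : I}
    {u v : FinDimRep (S.obj i)} {T : Matrix v.ι u.ι ℂ}
    (h : FinDimRep.Intertwines (u.pull (proj i)) (v.pull (proj i)) T) :
    ∃ (j : I) (hij : i ≤ j),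
      FinDimRep.Intertwines (u.pull (S.map hij)) (v.pull (S.map hij)) T := by
  rw [FinDimRep.intertwines_pull_iff] at h
  obtain ⟨j, hij, e⟩ := hG.exists_pullback_eq (i := i) (κ := v.ι × u.ι)
    (x := fun p => ∑ k, T p.1 k • u.coordMat k p.2)
    (y := fun p => ∑ k, T k p.2 • v.coordMat p.1 k) fun p => h p.1 p.2
  exact ⟨j, hij, (FinDimRep.intertwines_pull_iff _ T).2 fun a b => e (a, b)⟩

theorem exists_isConjugate_pull (hG : IsInverseLimit S G proj) {i : I}
    {u v : FinDimRep (S.obj i)} (h : (u.pull (proj i)).IsConjugate (v.pull (proj i))) :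
    ∃ (j : I) (hij : i ≤ j), (u.pull (S.map hij)).IsConjugate (v.pull (S.map hij)) := by
  obtain ⟨T, T', h, h₁, h₂⟩ := h
  rw [FinDimRep.conj_intertwines_pull_iff] at h
  obtain ⟨j, hij, e⟩ := hG.exists_pullback_eq (i := i) (κ := v.ι × u.ι)
    (x := fun p => ∑ k, T p.1 k • star (u.coordMat k p.2))
    (y := fun p => ∑ k, T k p.2 • v.coordMat p.1 k) fun p => h p.1 p.2
  exact ⟨j, hij, T, T', (FinDimRep.conj_intertwines_pull_iff (S.map hij) T).2 fun a b => e (a, b),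
    h₁, h₂⟩

/-- Two finite families of isomorphism classes of representations of `G_i` that agree over `G`
agree at a later stage. -/
theorem exists_map_eq (hG : IsInverseLimit S G proj) {i : I} {κ : Type*} [Finite κ]
    {a b : κ → RepClass (S.obj i)}
    (h : ∀ k, RepClass.map (proj i) (a k) = RepClass.map (proj i) (b k)) :
    ∃ (j : I) (hij : i ≤ j), ∀ k,
      RepClass.map (S.map hij) (a k) = RepClass.map (S.map hij) (b k) := by
  refine exists_ge_forall_of_finite
    (P := fun k j hij => RepClass.map (S.map hij) (a k) = RepClass.map (S.map hij) (b k))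
    ?_ fun k => ?_
  · intro k j l hij hjl e
    rw [← S.repClass_map_map hij hjl, e, S.repClass_map_map]
  · obtain ⟨u, hu⟩ := Quotient.exists_rep (a k)
    obtain ⟨v, hv⟩ := Quotient.exists_rep (b k)
    have hk := h k
    rw [← hu, ← hv] at hk ⊢
    obtain ⟨T, T', hT, h₁, h₂⟩ : FinDimRep.Equivalent (u.pull (proj i)) (v.pull (proj i)) :=
      Quotient.exact hk
    obtain ⟨j, hij, hj⟩ := hG.exists_intertwines_pull hT
    exact ⟨j, hij, Quotient.sound ⟨T, T', hj, h₁, h₂⟩⟩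

variable [Nonempty I]

theorem exists_lift (hG : IsInverseLimit S G proj) {κ : Type*} [Finite κ] (y : κ → G.coord) :
    ∃ (i : I) (x : κ → (S.obj i).coord), ∀ k, (proj i).pullback (x k) = y k := by
  choose i x hx using fun k => hG.jointly_surjective (y k)
  obtain ⟨M, hM⟩ := Finite.exists_le i
  exact ⟨M, fun k => (S.map (hM k)).pullback (x k), fun k => by rw [hG.compatible, hx]⟩

/-- Every representation of an inverse limit comes from a representation at some stage. -/
theorem exists_pull_eq (hG : IsInverseLimit S G proj) (u : FinDimRep G) :
    ∃ (i : I) (u' : FinDimRep (S.obj i)), u'.pull (proj i) = u := by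
  obtain ⟨i, x, hx⟩ := hG.exists_lift fun p : u.ι × u.ι => u.coordMat p.1 p.2
  -- An arbitrary lift of the coefficients: unitarity and the coproduct formula are known only after
  -- `proj i`. The two unitarity relations and the coproduct formula are attained at stages `j₁`,
  -- `j₂`, `j₃`.
  let m : Matrix u.ι u.ι (S.obj i).coord := Matrix.of fun a b => x (a, b)
  have hm : ∀ a b, (proj i).pullback (m a b) = u.coordMat a b := fun a b => hx (a, b)
  obtain ⟨j₁, h₁, e₁⟩ := hG.exists_pullback_eq (i := i) (κ := u.ι × u.ι)
    (x := fun p => (mᴴ * m) p.1 p.2) (y := fun p => (1 : Matrix u.ι u.ι _) p.1 p.2) fun p => by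
      have := congrFun (congrFun u.conjTranspose_coordMat_mul p.1) p.2
      simp only [Matrix.mul_apply, Matrix.conjTranspose_apply, Matrix.one_apply, ← hm] at this
      simp only [Matrix.mul_apply, Matrix.conjTranspose_apply, Matrix.one_apply, map_sum, map_mul,
        map_star, this]
      split_ifs <;> simp
  obtain ⟨j₂, h₂, e₂⟩ := hG.exists_pullback_eq (i := i) (κ := u.ι × u.ι)
    (x := fun p => (m * mᴴ) p.1 p.2) (y := fun p => (1 : Matrix u.ι u.ι _) p.1 p.2) fun p => by
      have := congrFun (congrFun u.coordMat_mul_conjTranspose p.1) p.2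
      simp only [Matrix.mul_apply, Matrix.conjTranspose_apply, Matrix.one_apply, ← hm] at this
      simp only [Matrix.mul_apply, Matrix.conjTranspose_apply, Matrix.one_apply, map_sum, map_mul,
        map_star, this]
      split_ifs <;> simp
  obtain ⟨j₃, h₃, e₃⟩ := hG.exists_tensorMap_eq (i := i) (κ := u.ι × u.ι)
    (x := fun p => (S.obj i).coordComul (m p.1 p.2))
    (y := fun p => ∑ k, m p.1 k ⊗ₜ m k p.2) fun p => by
      rw [(proj i).map_comul, hm, u.coordComul_coordMat, map_sum]
      refine Finset.sum_congr rfl fun k _ => ?_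
      rw [← hm, ← hm]
      rfl
  obtain ⟨j₁₂, h₁', h₂'⟩ := exists_ge_ge j₁ j₂
  obtain ⟨j, h', h₃'⟩ := exists_ge_ge j₁₂ j₃
  have hij := h₃.trans h₃'
  have hstar : (m.map (S.map hij).pullback)ᴴ = mᴴ.map (S.map hij).pullback := by
    ext a b : 1
    exact (map_star (S.map hij).pullback _).symm
  have hone : (1 : Matrix u.ι u.ι (S.obj i).coord).map (S.map hij).pullback = 1 :=
    Matrix.map_one _ (map_zero _) (map_one _)
  refine ⟨j, FinDimRep.ofCoord (m.map (S.map hij).pullback) ?_ ?_ ?_, ?_⟩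
  · rw [hstar, ← Matrix.map_mul, ← hone]
    ext a b : 1
    rw [Matrix.map_apply, Matrix.map_apply, ← S.map_comp h₁ (h₁'.trans h'), e₁ (a, b), S.map_comp]
  · rw [hstar, ← Matrix.map_mul, ← hone]
    ext a b : 1
    rw [Matrix.map_apply, Matrix.map_apply, ← S.map_comp h₂ (h₂'.trans h'), e₂ (a, b), S.map_comp]
  · intro a b
    have e := congrArg (TensorProduct.map (S.map h₃').pullback.toLinearMap
      (S.map h₃').pullback.toLinearMap) (e₃ (a, b))
    have hc : (S.map h₃').pullback.toLinearMap ∘ₗ (S.map h₃).pullback.toLinearMap =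
        (S.map hij).pullback.toLinearMap :=
      LinearMap.ext fun z => S.map_comp h₃ h₃' z
    rw [← LinearMap.comp_apply, ← LinearMap.comp_apply, ← TensorProduct.map_comp, hc,
      (S.map hij).map_comul, map_sum] at e
    exact e
  · refine FinDimRep.ofCoord_coordMat (u := u) ?_
    ext a b : 1
    exact (hG.compatible hij _).trans (hm a b)

theorem exists_map_eq_lift (hG : IsInverseLimit S G proj) {κ : Type*} [Finite κ]
    (a : κ → RepClass G) :
    ∃ (i : I) (a' : κ → RepClass (S.obj i)), ∀ k, RepClass.map (proj i) (a' k) = a k := by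
  have : ∀ k, ∃ (i : I) (a' : RepClass (S.obj i)), RepClass.map (proj i) a' = a k := fun k => by
    obtain ⟨u, hu⟩ := Quotient.exists_rep (a k)
    obtain ⟨i, u', h⟩ := hG.exists_pull_eq u
    refine ⟨i, RepClass.mk u', ?_⟩
    rw [RepClass.map_mk, h]
    exact hu
  choose i a' h using this
  obtain ⟨M, hM⟩ := Finite.exists_le i
  exact ⟨M, fun k => RepClass.map (S.map (hM k)) (a' k), fun k => by rw [hG.map_map, h]⟩

/-! ### The three properties pass to the limit. -/

theorem isIrreducible (hG : IsInverseLimit S G proj) (h : ∀ i, (S.obj i).IsIrreducible) :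
    G.IsIrreducible := by
  have : Nontrivial G.coord := ⟨⟨0, 1, fun e => zero_ne_one (congrArg Subtype.val e)⟩⟩
  have : NoZeroDivisors G.coord := ⟨fun {x y} hxy => by
    obtain ⟨i, z, hz⟩ := hG.exists_lift ![x, y]
    obtain ⟨j, hij, e⟩ := hG.eventually_zero i (z 0 * z 1) (by
      rw [map_mul, hz, hz]; exact hxy)
    have := h j
    rw [IsIrreducible] at this
    rw [map_mul, mul_eq_zero] at e
    refine e.imp (fun e => ?_) fun e => ?_
    · rw [show x = _ from (hz 0).symm, ← hG.compatible hij, e, map_zero]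
    · rw [show y = _ from (hz 1).symm, ← hG.compatible hij, e, map_zero]⟩
  exact NoZeroDivisors.to_isDomain _

theorem isWeaklyIrreducible (hG : IsInverseLimit S G proj)
    (h : ∀ i, (S.obj i).IsWeaklyIrreducible) : G.IsWeaklyIrreducible := by
  have : NoZeroDivisors (RepRing G) := ⟨fun {x y} hxy => by
    obtain ⟨a, b, rfl⟩ := RepRing.exists_eq_sub x
    obtain ⟨c, d, rfl⟩ := RepRing.exists_eq_sub y
    rw [RepRing.sub_mul_sub, sub_eq_zero, RepRing.of_eq_of_iff] at hxy
    obtain ⟨f, hf⟩ := hxy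
    -- The stabilizing summand `f` is lifted along with the four classes, so no cancellation law for
    -- representation classes is needed.
    obtain ⟨i, z, hz⟩ := hG.exists_map_eq_lift ![a, b, c, d, f]
    obtain ⟨j, hij, hj⟩ := hG.exists_map_eq (i := i) (κ := Unit)
      (a := fun _ => z 4 + (z 0 * z 2 + z 1 * z 3)) (b := fun _ => z 4 + (z 0 * z 3 + z 1 * z 2))
      fun _ => by
        simp only [map_add, map_mul, hz]
        exact hf
    have := h j
    rw [IsWeaklyIrreducible] at this
    have hj := hj ()
    simp only [map_add, map_mul] at hj
    have h0 := RepRing.of_eq_of_iff.2 ⟨_, hj⟩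
    rw [← sub_eq_zero, ← RepRing.sub_mul_sub, mul_eq_zero, sub_eq_zero, sub_eq_zero] at h0
    rw [sub_eq_zero, sub_eq_zero]
    refine h0.imp (fun h0 => ?_) fun h0 => ?_
    · have := RepRing.of_map_eq_of_map (proj j) h0
      rwa [hG.map_map, hG.map_map, hz, hz] at this
    · have := RepRing.of_map_eq_of_map (proj j) h0
      rwa [hG.map_map, hG.map_map, hz, hz] at this⟩
  exact NoZeroDivisors.to_isDomain _

theorem isConnected (hG : IsInverseLimit S G proj) (h : ∀ i, (S.obj i).IsConnected) :
    G.IsConnected := by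
  rintro u hu ⟨v, huv, hfin⟩
  set C := {c : RepClass G | ∃ w : FinDimRep G, RepClass.mk w = c ∧ w.IsIrreducible ∧
      ∃ n : ℕ, w.IsSubrep ((u.directSum v).tensorPow n)} with hC
  have : Finite C := hfin
  choose w hwmk hwirr n hwn using fun c : C => c.2
  have h1 : RepClass.mk (FinDimRep.trivial G) ∈ C :=
    ⟨_, rfl, FinDimRep.isIrreducible_trivial G, 0, FinDimRep.IsSubrep.refl _⟩
  -- `C` is closed under fusion with `u ⊕ v`: since `w c` lies in power `n c`, the constituents of
  -- the product lie in power `n c + 1`. The list records multiplicities.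
  have fusion : ∀ c : C, ∃ L : List C, RepClass.mk (w c) * RepClass.mk (u.directSum v) =
      (L.map fun d => RepClass.mk (w d)).sum := by
    intro c
    obtain ⟨L, hL, e⟩ := ((w c).tensor (u.directSum v)).exists_eq_sum_isIrreducible
    have hLC : ∀ x ∈ L.map RepClass.mk, x ∈ C := by
      intro x hx
      obtain ⟨y, hy, rfl⟩ := List.mem_map.1 hx
      exact ⟨y, rfl, (hL y hy).1, n c + 1, (hL y hy).2.trans ((hwn c).tensor_right _)⟩
    refine ⟨(L.map RepClass.mk).attachWith (· ∈ C) hLC, ?_⟩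
    simp only [hwmk, List.attachWith_map_subtype_val]
    have e' : RepClass.mk (w c) * RepClass.mk (u.directSum v) = (L.map RepClass.mk).sum := e
    rwa [hwmk] at e'
  choose L hL using fusion
  have lift : ∀ x : FinDimRep G, ∃ (i : I) (x' : FinDimRep (S.obj i)), x'.pull (proj i) = x :=
    hG.exists_pull_eq
  obtain ⟨iu, u₀, hu₀⟩ := lift u
  obtain ⟨iv, v₀, hv₀⟩ := lift v
  choose iw w₀ hw₀ using fun c => lift (w c)
  obtain ⟨iM, hM⟩ := Finite.exists_le iw
  obtain ⟨k, hk₁, hk₂⟩ := exists_ge_ge iu iv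
  obtain ⟨i, hki, hMi⟩ := exists_ge_ge k iM
  obtain ⟨u₁, hu₁⟩ : ∃ u₁ : FinDimRep (S.obj i), u₁.pull (proj i) = u :=
    ⟨u₀.pull (S.map (hk₁.trans hki)), by rw [hG.pull_pull, hu₀]⟩
  obtain ⟨v₁, hv₁⟩ : ∃ v₁ : FinDimRep (S.obj i), v₁.pull (proj i) = v :=
    ⟨v₀.pull (S.map (hk₂.trans hki)), by rw [hG.pull_pull, hv₀]⟩
  obtain ⟨w₁, hw₁⟩ : ∃ w₁ : C → FinDimRep (S.obj i), ∀ c, (w₁ c).pull (proj i) = w c :=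
    ⟨fun c => (w₀ c).pull (S.map ((hM c).trans hMi)), fun c => by rw [hG.pull_pull, hw₀]⟩
  obtain ⟨j₁, h₁, huv₁⟩ := hG.exists_isConjugate_pull (u := u₁) (v := v₁) (by rwa [hu₁, hv₁])
  -- The index `none` asks that the chosen lift of the trivial class become trivial; `some c` is the
  -- row of the fusion table at `c`.
  obtain ⟨j₂, h₂, hj₂⟩ := hG.exists_map_eq (i := i) (κ := Option C)
    (a := fun o => o.elim (RepClass.mk (w₁ ⟨_, h1⟩))
      fun c => RepClass.mk (w₁ c) * (RepClass.mk u₁ + RepClass.mk v₁))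
    (b := fun o => o.elim 1 fun c => ((L c).map fun d => RepClass.mk (w₁ d)).sum) (by
      rintro (_ | c)
      · simp only [Option.elim_none, map_one, RepClass.map_mk, hw₁, hwmk]
        rfl
      · simp only [Option.elim_some, map_mul, map_add, RepClass.map_mk, hw₁, hu₁, hv₁,
          map_list_sum, List.map_map, Function.comp_def]
        exact hL c)
  obtain ⟨j, h₁', h₂'⟩ := exists_ge_ge j₁ j₂
  have hij := h₁.trans h₁'
  obtain ⟨u₂, hu₂⟩ : ∃ u₂, u₂ = u₁.pull (S.map hij) := ⟨_, rfl⟩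
  obtain ⟨v₂, hv₂⟩ : ∃ v₂, v₂ = v₁.pull (S.map hij) := ⟨_, rfl⟩
  obtain ⟨w₂, hw₂⟩ : ∃ w₂ : C → FinDimRep (S.obj j), ∀ c, w₂ c = (w₁ c).pull (S.map hij) :=
    ⟨_, fun c => rfl⟩
  have hu₃ : u₂.pull (proj j) = u := by rw [hu₂, hG.pull_pull, hu₁]
  have hw₃ : ∀ c, (w₂ c).pull (proj j) = w c := fun c => by rw [hw₂, hG.pull_pull, hw₁]
  have huv₂ : u₂.IsConjugate v₂ := by
    have := huv₁.pull (S.map h₁')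
    rwa [S.pull_pull, S.pull_pull, ← hu₂, ← hv₂] at this
  have hirr₂ : ∀ c, (w₂ c).IsIrreducible := fun c =>
    FinDimRep.isIrreducible_of_pull (proj j) (by rw [hw₃]; exact hwirr c)
  have hj := fun o => congrArg (RepClass.map (S.map h₂')) (hj₂ o)
  simp only [S.repClass_map_map] at hj
  have hone : RepClass.mk (w₂ ⟨_, h1⟩) = 1 := by
    rw [hw₂]
    simpa only [Option.elim_none, map_one, RepClass.map_mk] using hj none
  have hfus : ∀ c, RepClass.mk (w₂ c) * RepClass.mk (u₂.directSum v₂) =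
      ((L c).map fun d => RepClass.mk (w₂ d)).sum := fun c => by
    have := hj (some c)
    simp only [Option.elim_some, map_mul, map_add, RepClass.map_mk, ← hw₂, ← hu₂, ← hv₂,
      map_list_sum, List.map_map, Function.comp_def] at this
    exact this
  -- Iterating the fusion table from the trivial representation decomposes all powers at stage `j`,
  -- so no further stage is needed although there are infinitely many powers.
  have hpow : ∀ n, ∃ L' : List C, RepClass.mk ((u₂.directSum v₂).tensorPow n) =
      (L'.map fun d => RepClass.mk (w₂ d)).sum := by
    intro n
    induction n with
    | zero => exact ⟨[⟨_, h1⟩], by simpa using! hone.symm⟩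
    | succ n ih =>
      obtain ⟨L', hL'⟩ := ih
      refine ⟨L'.flatMap L, ?_⟩
      change RepClass.mk ((u₂.directSum v₂).tensorPow n) * RepClass.mk (u₂.directSum v₂) = _
      rw [hL']
      clear hL'
      induction L' with
      | nil => simp
      | cons c L' ih =>
        rw [List.map_cons, List.sum_cons, add_mul, ih, hfus, List.flatMap_cons, List.map_append,
          List.sum_append]
  have htors : u₂.IsTorsion := by
    refine ⟨v₂, huv₂, (Set.finite_range fun c => RepClass.mk (w₂ c)).subset ?_⟩
    rintro _ ⟨x, rfl, hx, n, T, hT, hTT⟩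
    obtain ⟨L', hL'⟩ := hpow n
    have hT0 : T ≠ 0 := by
      rintro rfl
      obtain ⟨i⟩ := Fintype.card_pos_iff.1 hx.1
      simpa using congrFun (congrFun hTT i) i
    -- Schur's lemma identifies any irreducible constituent of a power with one of the finitely many
    -- `w₂ c`.
    obtain ⟨y, hy, e⟩ := hT.mk_mem_of_eq_sum hx (L'.map w₂) (fun y hy => by
      obtain ⟨c, -, rfl⟩ := List.mem_map.1 hy
      exact hirr₂ c) (by rw [hL', List.map_map]; rfl) hT0
    obtain ⟨c, -, rfl⟩ := List.mem_map.1 hy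
    exact ⟨c, e.symm⟩
  have htriv := h j u₂ (FinDimRep.isIrreducible_of_pull (proj j) (by rwa [hu₃])) htors
  have e : RepClass.map (proj j) (RepClass.mk u₂) = RepClass.map (proj j) 1 :=
    congrArg _ (Quotient.sound htriv)
  rw [RepClass.map_mk, hu₃, map_one] at e
  exact Quotient.exact e

end IsInverseLimit

end CompactQuantumGroup

end

theorem mainTheorem2 {I : Type*} [Preorder I] [Nonempty I] [IsDirectedOrder I]
    (S : CompactQuantumGroup.InverseSystem I) (G : CompactQuantumGroup)
    (proj : ∀ i, CompactQuantumGroup.Hom G (S.obj i))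
    (hG : CompactQuantumGroup.IsInverseLimit S G proj) :
    ((∀ i, (S.obj i).IsConnected) → G.IsConnected) ∧
    ((∀ i, (S.obj i).IsIrreducible) → G.IsIrreducible) ∧
    ((∀ i, (S.obj i).IsWeaklyIrreducible) → G.IsWeaklyIrreducible) :=
  ⟨hG.isConnected, hG.isIrreducible, hG.isWeaklyIrreducible⟩
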